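/- Let $N$ be a smooth finite-dimensional manifold without boundary and let $k\ge 1$. Let $M=\Lambda^kT^*N$ be the total space of the bundle of alternating $k$-forms on the tangent spaces of $N$, with projection $\pi\colon M\to N$. Let $\theta\in\Omega^k(M)$ be minus the canonical (tautological) $k$-form, i.e. $\theta_p(v_1,\dots,v_k)=-p(d\pi(v_1),\dots,d\pi(v_k))$ for $p\in M$ and $v_1,\dots,v_k\in T_pM$. Let $b\in\Omega^k(N)$, $a\in\Omega^{k-1}(N)$ and let $w$ be a vector field on $N$ (all smooth) such that $\mathcal L_w b=da$. Let $w^h$ be the canonical lift of $w$ to $M$, i.e. the generator of the flow $(\phi_t^{-1})^*$ on $M$ induced by the (local) flow $\phi_t$ of $w$; in local coordinates it has the component $w$ along the base and the component $-\sum_{i}p(\cdot,\dots,Dw(\cdot),\dots,\cdot)$ ($Dw$ applied to the $i$-th argument) along the fibre over the point $p$. Put $$\omega=d\theta+\pi^*db\in\Omega^{k+1}(M),\qquad H=-\pi^*a+\iota_{w^h}(\theta+\pi^*b)\in\Omega^{k-1}(M).$$ Then: 1. $\omega$ is a smooth closed $(k+1)$-form (it is pre-$k$-plectic), and if $k\le\dim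 N$ it is $k$-plectic, i.e. moreover for every $p\in M$ the map $T_pM\to\Lambda^kT_p^*M$, $v\mapsto\iota_v\omega_p$, is injective. 2. $w^h$ is a smooth vector field, $H$ is a smooth $(k-1)$-form, and $dH=-\iota_{w^h}\omega$; that is, $w^h$ is a Hamiltonian vector field on $(M,\omega)$ with Hamiltonian $(k-1)$-form $H$. -/

import Mathlib

open Bundle Set
open scoped Manifold ContDiff

noncomputable section

namespace Multisymplectic

/-! ### The bundle of alternating `k`-forms on the tangent spaces is a smooth vector bundle -/

section SmoothComposition

variable {V W : Type*} [NormedAddCommGroup V] [NormedSpace ℝ V]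
  [NormedAddCommGroup W] [NormedSpace ℝ W] {k : ℕ}

theorem norm_alternatization_le (f : ContinuousMultilinearMap ℝ (fun _ : Fin k => V) ℝ) :
    ‖ContinuousMultilinearMap.alternatization f‖ ≤ (k.factorial : ℝ) * ‖f‖ := by
  refine ContinuousAlternatingMap.opNorm_le_bound _ (by positivity) fun v => ?_
  rw [ContinuousMultilinearMap.alternatization_apply_apply]
  calc _ ≤ ∑ σ : Equiv.Perm (Fin k), ‖f‖ * ∏ i, ‖v i‖ := by
        refine norm_sum_le_of_le _ fun σ _ => ?_
        have h := f.le_opNorm (v ∘ σ)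
        have h2 : ∏ i, ‖(v ∘ σ) i‖ = ∏ i, ‖v i‖ := Equiv.prod_comp σ (fun i => ‖v i‖)
        rw [h2] at h
        rcases Int.units_eq_one_or (Equiv.Perm.sign σ) with hs | hs <;> rw [hs] <;> simpa using h
    _ = _ := by simp [Fintype.card_perm, mul_assoc]

/-- Precomposition of alternating forms with a linear map `A` depends smoothly on `A`. -/
theorem contDiff_compContinuousLinearMapCLM {n : WithTop ℕ∞} :
    ContDiff ℝ n (fun A : V →L[ℝ] W =>
      (ContinuousAlternatingMap.compContinuousLinearMapCLM A :
        (W [⋀^Fin k]→L[ℝ] ℝ) →L[ℝ] (V [⋀^Fin k]→L[ℝ] ℝ))) := by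
  let alt : ContinuousMultilinearMap ℝ (fun _ : Fin k => V) ℝ →L[ℝ] (V [⋀^Fin k]→L[ℝ] ℝ) :=
    AddMonoidHom.toRealLinearMap ContinuousMultilinearMap.alternatization
      (AddMonoidHomClass.continuous_of_bound _ _ norm_alternatization_le)
  let tm : (W [⋀^Fin k]→L[ℝ] ℝ) →L[ℝ] ContinuousMultilinearMap ℝ (fun _ : Fin k => W) ℝ :=
    ContinuousAlternatingMap.toContinuousMultilinearMapCLM ℝ
  let Q := ContinuousMultilinearMap.compContinuousLinearMapContinuousMultilinear ℝ
    (fun _ : Fin k => V) (fun _ : Fin k => W) ℝ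
  have key : (fun A : V →L[ℝ] W =>
      (ContinuousAlternatingMap.compContinuousLinearMapCLM A :
        (W [⋀^Fin k]→L[ℝ] ℝ) →L[ℝ] (V [⋀^Fin k]→L[ℝ] ℝ))) =
      fun A => (((k.factorial : ℝ)⁻¹) • alt) ∘L (Q (fun _ => A)) ∘L tm := by
    funext A
    ext η v
    have h : alt (Q (fun _ => A) (tm η)) = k.factorial • η.compContinuousLinearMap A := by
      have h1 := AlternatingMap.coe_alternatization (η.compContinuousLinearMap A).toAlternatingMap
      rw [Fintype.card_fin] at h1
      ext u
      have h2 := congrArg (fun g => g u) h1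
      simp only [MultilinearMap.alternatization_apply] at h2
      change ContinuousMultilinearMap.alternatization ((Q fun _ => A) (tm η)) u = _
      rw [ContinuousMultilinearMap.alternatization_apply_apply]
      refine Eq.trans ?_ (h2.trans ?_)
      · exact Finset.sum_congr rfl fun σ _ => rfl
      · simp
    have hk : (k.factorial : ℝ) ≠ 0 := by positivity
    simp [h, hk]
  rw [key]
  refine contDiff_const.clm_comp (ContDiff.clm_comp ?_ contDiff_const)
  have hQ : ContDiff ℝ n Q := by
    exact ContinuousMultilinearMap.contDiff (𝕜 := ℝ) (E := fun _ : Fin k => V →L[ℝ] W)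
      (F := ContinuousMultilinearMap ℝ (fun _ : Fin k => W) ℝ →L[ℝ]
        ContinuousMultilinearMap ℝ (fun _ : Fin k => V) ℝ) Q
  exact hQ.comp (contDiff_pi.2 fun _ => contDiff_id)

end SmoothComposition

section FormBundle

variable {E H : Type*} [NormedAddCommGroup E] [NormedSpace ℝ E] [TopologicalSpace H]
  (I : ModelWithCorners ℝ E H) (M : Type*) [TopologicalSpace M] [ChartedSpace H M]

/-- The total space of `Λ^k T^*M`, the bundle whose fibre at `x` consists of the alternating
`k`-linear forms on `T_x M`. Topology and charts are those of Mathlib's bundle of alternating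
maps. -/
abbrev FormBundle (k : ℕ) :=
  TotalSpace (E [⋀^Fin k]→L[ℝ] ℝ) (fun x : M => TangentSpace I x [⋀^Fin k]→L[ℝ] ℝ)

/-- The model with corners of the manifold `Λ^k T^*M`. -/
abbrev formModel (k : ℕ) : ModelWithCorners ℝ (E × (E [⋀^Fin k]→L[ℝ] ℝ))
    (ModelProd H (E [⋀^Fin k]→L[ℝ] ℝ)) :=
  I.prod 𝓘(ℝ, E [⋀^Fin k]→L[ℝ] ℝ)

/-- `Λ^k T^*M` is a smooth vector bundle; hence its total space is a smooth manifold. -/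
instance contMDiffVectorBundle_forms [IsManifold I ∞ M] (k : ℕ) :
    ContMDiffVectorBundle ∞ (E [⋀^Fin k]→L[ℝ] ℝ)
      (fun x : M => TangentSpace I x [⋀^Fin k]→L[ℝ] ℝ) I := by
  have : (Bundle.ContinuousAlternatingMap.vectorPrebundle ℝ (Fin k) E
      (TangentSpace I : M → Type _) ℝ (Bundle.Trivial M ℝ)).IsContMDiff I ∞ := by
    constructor
    rintro _ ⟨e₁, e₂, he₁, he₂, rfl⟩ _ ⟨e₁', e₂', he₁', he₂', rfl⟩
    refine ⟨Pretrivialization.continuousAlternatingMapCoordChange ℝ (Fin k) e₁ e₁' e₂ e₂', ?_,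
      Pretrivialization.continuousAlternatingMapCoordChange_apply⟩
    simp +unfoldPartialApp only [Pretrivialization.continuousAlternatingMapCoordChange,
      ContinuousLinearEquiv.coe_continuousAlternatingMapCongr, ContinuousLinearEquiv.symm_symm]
    refine ContMDiffOn.clm_comp ?_ ?_
    · have h := (contMDiffOn_coordChangeL (n := ∞) (IB := I) e₂ e₂')
      have hc : ContDiff ℝ ∞ (fun A : ℝ →L[ℝ] ℝ =>
          (ContinuousLinearMap.compContinuousAlternatingMapCLM (ι := Fin k) ℝ E ℝ ℝ A :
            (E [⋀^Fin k]→L[ℝ] ℝ) →L[ℝ] (E [⋀^Fin k]→L[ℝ] ℝ))) := by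
        exact ContinuousLinearMap.contDiff (𝕜 := ℝ) (E := ℝ →L[ℝ] ℝ)
          (F := (E [⋀^Fin k]→L[ℝ] ℝ) →L[ℝ] (E [⋀^Fin k]→L[ℝ] ℝ))
          (ContinuousLinearMap.compContinuousAlternatingMapCLM (ι := Fin k) ℝ E ℝ ℝ)
      exact (hc.contMDiff.comp_contMDiffOn h).mono fun y hy => ⟨hy.1.2, hy.2.2⟩
    · have h := (contMDiffOn_coordChangeL (n := ∞) (IB := I) e₁' e₁)
      exact (contDiff_compContinuousLinearMapCLM.contMDiff.comp_contMDiffOn h).mono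
        fun y hy => ⟨hy.2.1, hy.1.1⟩
  exact (Bundle.ContinuousAlternatingMap.vectorPrebundle ℝ (Fin k) E
    (TangentSpace I : M → Type _) ℝ (Bundle.Trivial M ℝ)).contMDiffVectorBundle I

end FormBundle

/-! ### Vector fields, differential forms and their calculus -/

section Calculus

variable {E H : Type*} [NormedAddCommGroup E] [NormedSpace ℝ E] [TopologicalSpace H]
  (I : ModelWithCorners ℝ E H) {M : Type*} [TopologicalSpace M] [ChartedSpace H M]
  {E' H' : Type*} [NormedAddCommGroup E'] [NormedSpace ℝ E'] [TopologicalSpace H']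
  (I' : ModelWithCorners ℝ E' H') {M' : Type*} [TopologicalSpace M'] [ChartedSpace H' M']
  {k : ℕ}

variable (M) in
/-- A (not necessarily smooth) vector field on `M`. -/
abbrev VField := Π x : M, TangentSpace I x

variable (M) in
/-- A (not necessarily smooth) differential `k`-form on `M`. -/
abbrev DForm (k : ℕ) := Π x : M, TangentSpace I x [⋀^Fin k]→L[ℝ] ℝ

/-- Smoothness of a vector field, as a section of the tangent bundle. -/
def IsSmoothField [IsManifold I ∞ M] (w : VField I M) : Prop :=
  ContMDiff I I.tangent ∞ (fun x => (⟨x, w x⟩ : TangentBundle I M))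

/-- Smoothness of a `k`-form, as a section of `Λ^k T^*M`. -/
def IsSmoothForm [IsManifold I ∞ M] (α : DForm I M k) : Prop :=
  ContMDiff I (formModel I k) ∞ (fun x => (⟨x, α x⟩ : FormBundle I M k))

/-- The pullback `f^* α`. -/
def pullback (f : M → M') (α : DForm I' M' k) : DForm I M k :=
  fun x => (α (f x)).compContinuousLinearMap (mfderiv I I' f x)

/-- Insertion of a vector in the first slot of an alternating form. -/
def insertVector {V : Type*} [AddCommGroup V] [Module ℝ V] [TopologicalSpace V]
    (v : V) (η : V [⋀^Fin (k + 1)]→L[ℝ] ℝ) : V [⋀^Fin k]→L[ℝ] ℝ :=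
  { η.toAlternatingMap.curryLeft v with
    cont := η.cont.comp (continuous_const.matrixVecCons continuous_id) }

/-- The interior product `ι_w α`, with `(ι_w α)(v₁, …, v_k) = α(w, v₁, …, v_k)`. -/
def interior (w : VField I M) (α : DForm I M (k + 1)) : DForm I M k :=
  fun x => insertVector (w x) (α x)

/-- The form `α` read in the preferred chart around `x`, i.e. its pullback under the inverse of the
chart. -/
def chartForm (x : M) (α : DForm I M k) : E → E [⋀^Fin k]→L[ℝ] ℝ :=
  fun y => (α ((extChartAt I x).symm y)).compContinuousLinearMap
    (mfderivWithin 𝓘(ℝ, E) I (extChartAt I x).symm (range I) y)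

/-- The vector field `w` read in the preferred chart around `x`. -/
def chartField (x : M) (w : VField I M) : E → E :=
  VectorField.mpullbackWithin 𝓘(ℝ, E) I (extChartAt I x).symm w (range I)

/-- The alternating form on `T_x M` with a given expression in the preferred chart around `x`. -/
def ofChart (x : M) (η : E [⋀^Fin k]→L[ℝ] ℝ) : TangentSpace I x [⋀^Fin k]→L[ℝ] ℝ :=
  η.compContinuousLinearMap (mfderiv I 𝓘(ℝ, E) (extChartAt I x) x)

/-- The exterior derivative: `(dα)_x` is computed in the chart around `x`. -/
def extD (α : DForm I M k) : DForm I M (k + 1) :=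
  fun x => ofChart I x (extDerivWithin (chartForm I x α) (range I) (extChartAt I x x))

/-- For `η` an alternating form and `A` an endomorphism, the alternating form
`(v₁, …, v_k) ↦ ∑ i, η(v₁, …, A vᵢ, …, v_k)`. -/
def derivationAction {V : Type*} [NormedAddCommGroup V] [NormedSpace ℝ V]
    (A : V →L[ℝ] V) (η : V [⋀^Fin k]→L[ℝ] ℝ) : V [⋀^Fin k]→L[ℝ] ℝ :=
  η.fderivCompContinuousLinearMap (ContinuousLinearMap.id ℝ V) A

theorem derivationAction_apply {V : Type*} [NormedAddCommGroup V] [NormedSpace ℝ V]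
    (A : V →L[ℝ] V) (η : V [⋀^Fin k]→L[ℝ] ℝ) (v : Fin k → V) :
    derivationAction A η v = ∑ i, η (Function.update v i (A (v i))) := by
  rw [derivationAction, ContinuousAlternatingMap.fderivCompContinuousLinearMap_apply]
  refine Finset.sum_congr rfl fun i _ => congrArg η (funext fun j => ?_)
  by_cases h : j = i
  · subst h; simp
  · simp [h]

/-- The Lie derivative `L_w α`. In the chart around `x`, where `w` reads `W` and `α` reads `Ω`,
`(L_W Ω)(v₁, …, v_k) = (D_W Ω)(v₁, …, v_k) + ∑ i, Ω(v₁, …, DW(vᵢ), …, v_k)`; this is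
the derivative at time zero of the pullback of `α` under the flow of `w`. -/
def lieD (w : VField I M) (α : DForm I M k) : DForm I M k :=
  fun x => ofChart I x
    (fderivWithin ℝ (chartForm I x α) (range I) (extChartAt I x x)
        (chartField I x w (extChartAt I x x)) +
      derivationAction (fderivWithin ℝ (chartField I x w) (range I) (extChartAt I x x))
        (chartForm I x α (extChartAt I x x)))

end Calculus

/-! ### Multisymplectic notions -/

section Plectic

variable {E H : Type*} [NormedAddCommGroup E] [NormedSpace ℝ E] [TopologicalSpace H]
  (I : ModelWithCorners ℝ E H) {M : Type*} [TopologicalSpace M] [ChartedSpace H M]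
  [IsManifold I ∞ M] {n : ℕ}

/-- `σ` is a pre-`n`-plectic form: a smooth closed `(n + 1)`-form. -/
structure IsPrePlectic (σ : DForm I M (n + 1)) : Prop where
  smooth : IsSmoothForm I σ
  closed : extD I σ = 0

/-- `σ` is an `n`-plectic form: it is pre-`n`-plectic and `v ↦ ι_v σ_p` is injective on every
tangent space. -/
structure IsPlectic (σ : DForm I M (n + 1)) : Prop extends IsPrePlectic I σ where
  nondegenerate : ∀ p : M, Function.Injective
    (fun v : TangentSpace I p => insertVector v (σ p))

/-- `v` is a Hamiltonian vector field for the smooth form `α` (which is therefore a Hamiltonian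
form), with respect to `σ`: `dα = - ι_v σ`. Here `σ` has degree `n + 2` and `α` has degree `n`. -/
structure IsHamiltonianField (σ : DForm I M (n + 2)) (α : DForm I M n) (v : VField I M) :
    Prop where
  smooth_form : IsSmoothForm I α
  smooth_field : IsSmoothField I v
  eq : extD I α = - interior I v σ

end Plectic

/-! ### The geometry of `Λ^k T^*N` -/

section Canonical

variable {E H : Type*} [NormedAddCommGroup E] [NormedSpace ℝ E] [TopologicalSpace H]
  (I : ModelWithCorners ℝ E H) {N : Type*} [TopologicalSpace N] [ChartedSpace H N]
  [IsManifold I ∞ N] (k : ℕ)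

variable (N) in
/-- The projection `π : Λ^k T^*N → N`. -/
def proj : FormBundle I N k → N := fun p => p.proj

variable (N) in
/-- The canonical (tautological) `k`-form on `Λ^k T^*N`, whose value at `p` is
`(v₁, …, v_k) ↦ p(dπ v₁, …, dπ v_k)`. -/
def tautologicalForm : DForm (formModel I k) (FormBundle I N k) k :=
  fun p => p.snd.compContinuousLinearMap (mfderiv (formModel I k) I (proj I N k) p)

variable (N) in
/-- The form `θ`; the canonical `k`-form is `-θ`. -/
def theta : DForm (formModel I k) (FormBundle I N k) k := -tautologicalForm I N k

/-- The canonical lift `w^h` of the vector field `w` to `Λ^k T^*N`, i.e. the generator of the flow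
`(φ_t⁻¹)^*` that the flow `φ_t` of `w` induces on `Λ^k T^*N`. In the bundle chart around `p` that is
induced by the chart of `N` around `π p`, where `w` reads `W` and `p` has the coordinates
`(y, η)`, its components are `W(y)` along the base and `- ∑ i, η(…, DW(y) vᵢ, …)` along
the fibre. For `k = 1` this is the vector field
`∑ W^i ∂/∂q^i - ∑ p_j (∂W^j/∂q^i) ∂/∂p_i`. -/
def canonicalLift (w : VField I N) : VField (formModel I k) (FormBundle I N k) :=
  fun p =>
    let c := extChartAt (formModel I k) p
    let W : E → E := chartField I (proj I N k p) w
    mfderivWithin 𝓘(ℝ, E × (E [⋀^Fin k]→L[ℝ] ℝ)) (formModel I k) c.symm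
      (range (formModel I k)) (c p)
      ((W (c p).1, - derivationAction (fderivWithin ℝ W (range I) (c p).1) (c p).2) :
        E × (E [⋀^Fin k]→L[ℝ] ℝ))

variable {I k}

/-- The form `ω = dθ + π^* db` on `Λ^k T^*N`. -/
def magneticForm (b : DForm I N k) :
    DForm (formModel I k) (FormBundle I N k) (k + 1) :=
  extD (formModel I k) (theta I N k) + pullback (formModel I k) I (proj I N k) (extD I b)

/-- The form `H = - π^* a + ι_{w^h} (θ + π^* b)` on `Λ^{k+1} T^*N`, where `b` has degree `k + 1`
and `a` has degree `k`. -/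
def magneticHamiltonian (w : VField I N) (b : DForm I N (k + 1)) (a : DForm I N k) :
    DForm (formModel I (k + 1)) (FormBundle I N (k + 1)) k :=
  - pullback (formModel I (k + 1)) I (proj I N (k + 1)) a +
    interior (formModel I (k + 1)) (canonicalLift I (k + 1) w)
      (theta I N (k + 1) + pullback (formModel I (k + 1)) I (proj I N (k + 1)) b)

end Canonical

end Multisymplectic

end

open Multisymplectic

/-! Put `Θ = θ + π^*b`. Since `d` commutes with pullback, `ω = dΘ`, so `ω` is closed because `d² =
0` (`magneticForm_eq_extD`, `extD_extD`).

Nondegeneracy is linear algebra in a bundle chart, where `ω` is `π^*db` minus the differential of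
the flat tautological form. If `(x, ξ)` is in the kernel, pairing it with one vertical vector `(0,
ζ)` and horizontal vectors gives `ζ(x, …) = 0` for every `ζ`. When the degree is at most the
dimension this forces `x = 0`. Purely horizontal vectors then give `ξ = 0`
(`injective_curryLeft_flat`).

The Hamiltonian identity is Cartan's formula (`extD_interior_add_interior_extD`) for `Θ` along
`w^h`: `dι_{w^h}Θ + ι_{w^h}ω = L_{w^h}Θ`. The lift preserves `θ` (`lieD_canonicalLift_theta`) and is
`π`-related to `w` (`lieD_canonicalLift_pullback`), so the right side is `π^*L_w b = π^*da`.
Subtracting `π^*da` yields `dH = -ι_{w^h}ω`.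

Each of these facts is proved on a normed space and carried over by charts. The work lies in the
fact that `extD` and `canonicalLift` are defined at each point by the chart centred there, whereas
differentiating them needs their expression in one fixed chart on an open set. This is supplied by
`chartForm_extD` and `chartField_canonicalLift`; the latter rests on the symmetry of second
derivatives, in `fderiv_apply_flatLift`. -/

namespace Multisymplectic

open ContinuousAlternatingMap Filter Topology

set_option linter.unusedSectionVars false

/-! ### Cartan calculus on a normed space. -/

section Flat

variable {V V' : Type*} [NormedAddCommGroup V] [NormedSpace ℝ V] [NormedAddCommGroup V']
  [NormedSpace ℝ V'] {k : ℕ}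

/-- This is the shape in which the `DX` term appears when the product rule is applied to a
contraction and the result is alternatized. -/
theorem derivationAction_eq_alternatizeUncurryFin (A : V →L[ℝ] V)
    (η : V [⋀^Fin (k + 1)]→L[ℝ] ℝ) :
    derivationAction A η = alternatizeUncurryFin (η.curryLeft ∘L A) := by
  rw [derivationAction, fderivCompContinuousLinearMap_eq_alternatizeUncurryFin]
  rfl

variable (V k) in
/-- `ContinuousAlternatingMap.curryLeft` as a continuous linear map. -/
noncomputable def curryLeftCLM :
    (V [⋀^Fin (k + 1)]→L[ℝ] ℝ) →L[ℝ] V →L[ℝ] V [⋀^Fin k]→L[ℝ] ℝ :=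
  curryLeftLI.toContinuousLinearMap

theorem curryLeftCLM_apply (η : V [⋀^Fin (k + 1)]→L[ℝ] ℝ) : curryLeftCLM V k η = η.curryLeft := rfl

/-- The algebraic part of the Cartan formula. -/
theorem alternatizeUncurryFin_curryLeft_add (L : V →L[ℝ] V [⋀^Fin (k + 1)]→L[ℝ] ℝ) (x : V) :
    alternatizeUncurryFin ((curryLeftCLM V k).flip x ∘L L) +
      (alternatizeUncurryFin L).curryLeft x = L x := by
  ext v
  simp only [ContinuousAlternatingMap.add_apply, curryLeft_apply_apply,
    alternatizeUncurryFin_apply]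
  -- The term `i = 0` is `L x v`. In every other term `x` stays in the first slot and the sign
  -- shifts by one, so it cancels against the first summand.
  rw [Fin.sum_univ_succ (n := k + 1)]
  have h (i : Fin (k + 1)) : i.succ.removeNth (Matrix.vecCons x v) =
      Matrix.vecCons x (i.removeNth v) := by
    funext j
    refine Fin.cases ?_ (fun j => ?_) j <;> simp [Fin.removeNth]
  have h0 : Fin.removeNth 0 (Matrix.vecCons x v) = v := by
    funext j
    simp [Fin.removeNth]
  simp only [h, h0, Matrix.cons_val_zero, Matrix.cons_val_succ, Fin.val_succ, pow_succ,
    Fin.val_zero, pow_zero, one_smul]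
  simp [Finset.sum_neg_distrib, curryLeftCLM_apply]

/-- The Cartan formula on a normed space. -/
theorem extDeriv_curryLeft_add_curryLeft_extDeriv {α : V → V [⋀^Fin (k + 1)]→L[ℝ] ℝ} {X : V → V}
    {x : V} (hα : DifferentiableAt ℝ α x) (hX : DifferentiableAt ℝ X x) :
    extDeriv (fun y => (α y).curryLeft (X y)) x + (extDeriv α x).curryLeft (X x) =
      fderiv ℝ α x (X x) + derivationAction (fderiv ℝ X x) (α x) := by
  have h : HasFDerivAt (fun y => (α y).curryLeft (X y))
      ((α x).curryLeft ∘L fderiv ℝ X x + (curryLeftCLM V k).flip (X x) ∘L fderiv ℝ α x) x := by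
    have h1 : HasFDerivAt (fun y => (α y).curryLeft) (curryLeftCLM V k ∘L fderiv ℝ α x) x :=
      HasFDerivAt.comp x (g := curryLeftCLM V k) (ContinuousLinearMap.hasFDerivAt _) hα.hasFDerivAt
    exact h1.clm_apply hX.hasFDerivAt
  -- Of the two terms of the product rule, the one with `DX` alternatizes to the derivation action;
  -- the one with `Dα` combines with `ι_X dα` to `D_X α`.
  rw [extDeriv, h.fderiv, alternatizeUncurryFin_add, derivationAction_eq_alternatizeUncurryFin,
    ← alternatizeUncurryFin_curryLeft_add (fderiv ℝ α x) (X x), extDeriv]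
  abel

/-- Naturality under a map intertwining `A` and `B`. It is applied with `p` the projection to the
base, `A` the derivative of a lifted field and `B` that of the field itself. -/
theorem derivationAction_compContinuousLinearMap (p : V →L[ℝ] V') {A : V →L[ℝ] V}
    {B : V' →L[ℝ] V'} (h : p ∘L A = B ∘L p) (η : V' [⋀^Fin k]→L[ℝ] ℝ) :
    derivationAction A (η.compContinuousLinearMap p) =
      (derivationAction B η).compContinuousLinearMap p := by
  ext v
  simp only [derivationAction_apply, compContinuousLinearMap_apply]
  refine Finset.sum_congr rfl fun i _ => congrArg η (funext fun j => ?_)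
  by_cases hj : j = i
  · subst hj
    simpa using DFunLike.congr_fun h (v j)
  · simp [hj]

theorem contDiffAt_compContinuousLinearMap {n : WithTop ℕ∞} {U : Type*} [NormedAddCommGroup U]
    [NormedSpace ℝ U] {α : U → V' [⋀^Fin k]→L[ℝ] ℝ} {A : U → V →L[ℝ] V'} {x : U}
    (hα : ContDiffAt ℝ n α x) (hA : ContDiffAt ℝ n A x) :
    ContDiffAt ℝ n (fun y => (α y).compContinuousLinearMap (A y)) x :=
  (contDiff_compContinuousLinearMapCLM.contDiffAt.comp x hA).clm_apply hα

theorem contDiffAt_curryLeft {n : WithTop ℕ∞} {U : Type*} [NormedAddCommGroup U]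
    [NormedSpace ℝ U] {α : U → V [⋀^Fin (k + 1)]→L[ℝ] ℝ} {X : U → V} {x : U}
    (hα : ContDiffAt ℝ n α x) (hX : ContDiffAt ℝ n X x) :
    ContDiffAt ℝ n (fun y => (α y).curryLeft (X y)) x :=
  ContDiffAt.clm_apply (f := fun y => (α y).curryLeft)
    (ContDiffAt.comp x (g := curryLeftCLM V k) (ContinuousLinearMap.contDiff _).contDiffAt hα) hX

theorem contDiffAt_extDeriv {α : V → V [⋀^Fin k]→L[ℝ] ℝ} {x : V} (hα : ContDiffAt ℝ ∞ α x) :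
    ContDiffAt ℝ ∞ (extDeriv α) x :=
  (alternatizeUncurryFinCLM ℝ V ℝ).contDiff.contDiffAt.comp x (hα.fderiv_right (by simp))

theorem contDiffAt_derivationAction {n : WithTop ℕ∞} {U : Type*} [NormedAddCommGroup U]
    [NormedSpace ℝ U] {A : U → V →L[ℝ] V} {α : U → V [⋀^Fin k]→L[ℝ] ℝ} {x : U}
    (hA : ContDiffAt ℝ n A x) (hα : ContDiffAt ℝ n α x) :
    ContDiffAt ℝ n (fun y => derivationAction (A y) (α y)) x :=
  ContDiffAt.clm_apply
    (f := fun y => (α y).fderivCompContinuousLinearMap (ContinuousLinearMap.id ℝ V))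
    (ContDiffAt.comp x
      (g := fderivCompContinuousLinearMapCLM ℝ (ContinuousLinearMap.id ℝ V))
      (ContinuousLinearMap.contDiff _).contDiffAt hα) hA

end Flat

/-! ### The tautological form and lifted vector fields on `E × Λ^k E^*`. -/

section FlatPhaseSpace

variable {E : Type*} [NormedAddCommGroup E] [NormedSpace ℝ E] {k : ℕ}

variable (E k) in
/-- The tautological `k`-form on `E × Λ^k E^*`, as a linear map in the point. -/
noncomputable def flatTautological : (E × (E [⋀^Fin k]→L[ℝ] ℝ)) →L[ℝ]
    (E × (E [⋀^Fin k]→L[ℝ] ℝ)) [⋀^Fin k]→L[ℝ] ℝ :=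
  compContinuousLinearMapCLM (ContinuousLinearMap.fst ℝ E (E [⋀^Fin k]→L[ℝ] ℝ)) ∘L
    ContinuousLinearMap.snd ℝ E (E [⋀^Fin k]→L[ℝ] ℝ)

theorem flatTautological_apply (z : E × (E [⋀^Fin k]→L[ℝ] ℝ)) :
    flatTautological E k z =
      z.2.compContinuousLinearMap (ContinuousLinearMap.fst ℝ E (E [⋀^Fin k]→L[ℝ] ℝ)) := rfl

/-- The tautological form is linear in the point, so it is its own derivative and only the
alternatization remains. -/
theorem extDeriv_flatTautological_apply (z : E × (E [⋀^Fin k]→L[ℝ] ℝ))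
    (v : Fin (k + 1) → E × (E [⋀^Fin k]→L[ℝ] ℝ)) :
    extDeriv (flatTautological E k) z v =
      ∑ i : Fin (k + 1), (-1) ^ (i : ℕ) • (v i).2 (fun j => (i.removeNth v j).1) := by
  rw [extDeriv, ContinuousLinearMap.fderiv, alternatizeUncurryFin_apply]
  rfl

/-- The lift to `E × Λ^k E^*` of a vector field `W` on `E`. -/
noncomputable def flatLift (W : E → E) (z : E × (E [⋀^Fin k]→L[ℝ] ℝ)) :
    E × (E [⋀^Fin k]→L[ℝ] ℝ) :=
  (W z.1, - derivationAction (fderiv ℝ W z.1) z.2)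

theorem contDiffAt_flatLift {W : E → E} {z : E × (E [⋀^Fin k]→L[ℝ] ℝ)}
    (hW : ContDiffAt ℝ ∞ W z.1) : ContDiffAt ℝ ∞ (flatLift W) z := by
  have h1 : ContDiffAt ℝ ∞ (fun z : E × (E [⋀^Fin k]→L[ℝ] ℝ) => fderiv ℝ W z.1) z :=
    (hW.fderiv_right (m := ∞) (by simp)).comp z contDiffAt_fst
  exact (hW.comp z contDiffAt_fst).prodMk (contDiffAt_derivationAction h1 contDiffAt_snd).neg

/-- The lift projects to `W`; differentiate that relation. -/
theorem fst_comp_fderiv_flatLift {W : E → E} {z : E × (E [⋀^Fin k]→L[ℝ] ℝ)}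
    (hW : ContDiffAt ℝ ∞ W z.1) :
    ContinuousLinearMap.fst ℝ E (E [⋀^Fin k]→L[ℝ] ℝ) ∘L fderiv ℝ (flatLift W) z =
      fderiv ℝ W z.1 ∘L ContinuousLinearMap.fst ℝ E (E [⋀^Fin k]→L[ℝ] ℝ) := by
  have h1 := (contDiffAt_flatLift hW).differentiableAt (by simp) |>.hasFDerivAt.fst
  have h2 := (hW.differentiableAt (by simp)).hasFDerivAt.comp z (hasFDerivAt_fst (p := z))
  exact h1.unique h2

/-- The Lie derivative of the tautological form along a lifted vector field vanishes. -/
theorem lie_flatLift_flatTautological {W : E → E} {z : E × (E [⋀^Fin k]→L[ℝ] ℝ)}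
    (hW : ContDiffAt ℝ ∞ W z.1) :
    fderiv ℝ (flatTautological E k) z (flatLift W z) +
      derivationAction (fderiv ℝ (flatLift W) z) (flatTautological E k z) = 0 := by
  -- By linearity the first term only sees the fibre component of the lift, which is minus the
  -- action of `DW`; by naturality the second term is plus that action.
  rw [ContinuousLinearMap.fderiv, flatTautological_apply, flatTautological_apply,
    derivationAction_compContinuousLinearMap _ (fst_comp_fderiv_flatLift hW)]
  ext v
  simp [flatLift]

/-- The Lie derivative along a lifted vector field of a form pulled back from the base. -/
theorem lie_flatLift_comp_fst {W : E → E} {z : E × (E [⋀^Fin k]→L[ℝ] ℝ)} {m : ℕ}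
    {β : E → E [⋀^Fin m]→L[ℝ] ℝ} (hW : ContDiffAt ℝ ∞ W z.1) (hβ : DifferentiableAt ℝ β z.1) :
    fderiv ℝ (fun z : E × (E [⋀^Fin k]→L[ℝ] ℝ) =>
        (β z.1).compContinuousLinearMap (ContinuousLinearMap.fst ℝ E (E [⋀^Fin k]→L[ℝ] ℝ))) z
          (flatLift W z) +
      derivationAction (fderiv ℝ (flatLift W) z)
        ((β z.1).compContinuousLinearMap (ContinuousLinearMap.fst ℝ E (E [⋀^Fin k]→L[ℝ] ℝ))) =
    (fderiv ℝ β z.1 (W z.1) + derivationAction (fderiv ℝ W z.1) (β z.1)).compContinuousLinearMap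
      (ContinuousLinearMap.fst ℝ E (E [⋀^Fin k]→L[ℝ] ℝ)) := by
  let C : (E [⋀^Fin m]→L[ℝ] ℝ) →L[ℝ] (E × (E [⋀^Fin k]→L[ℝ] ℝ)) [⋀^Fin m]→L[ℝ] ℝ :=
    compContinuousLinearMapCLM (ContinuousLinearMap.fst ℝ E (E [⋀^Fin k]→L[ℝ] ℝ))
  have h : HasFDerivAt (fun z : E × (E [⋀^Fin k]→L[ℝ] ℝ) =>
      (β z.1).compContinuousLinearMap (ContinuousLinearMap.fst ℝ E (E [⋀^Fin k]→L[ℝ] ℝ)))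
      (C ∘L (fderiv ℝ β z.1 ∘L ContinuousLinearMap.fst ℝ E (E [⋀^Fin k]→L[ℝ] ℝ))) z :=
    HasFDerivAt.comp z (g := C) (f := fun z : E × (E [⋀^Fin k]→L[ℝ] ℝ) => β z.1)
      (ContinuousLinearMap.hasFDerivAt (𝕜 := ℝ) (E := E [⋀^Fin m]→L[ℝ] ℝ)
        (F := (E × (E [⋀^Fin k]→L[ℝ] ℝ)) [⋀^Fin m]→L[ℝ] ℝ) C)
      (hβ.hasFDerivAt.comp z (hasFDerivAt_fst (p := z)))
  rw [h.fderiv, derivationAction_compContinuousLinearMap _ (fst_comp_fderiv_flatLift hW)]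
  rfl

/-- Lifting vector fields is compatible with coordinate changes. -/
theorem fderiv_apply_flatLift {φ ψ : E → E} {W W' : E → E} {z : E × (E [⋀^Fin k]→L[ℝ] ℝ)}
    (hφ : ContDiffAt ℝ ∞ φ z.1) (hψ : ContDiffAt ℝ ∞ ψ (φ z.1))
    (hψφ : ψ (φ z.1) = z.1) (hφψ : φ ∘ ψ =ᶠ[𝓝 (φ z.1)] id)
    (hW : DifferentiableAt ℝ W z.1) (hW' : DifferentiableAt ℝ W' (φ z.1))
    (h : ∀ᶠ x in 𝓝 (φ z.1), W (ψ x) = fderiv ℝ ψ x (W' x)) :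
    fderiv ℝ (fun z : E × (E [⋀^Fin k]→L[ℝ] ℝ) =>
        (φ z.1, z.2.compContinuousLinearMap (fderiv ℝ ψ (φ z.1)))) z (flatLift W z) =
      flatLift W' (φ z.1, z.2.compContinuousLinearMap (fderiv ℝ ψ (φ z.1))) := by
  obtain ⟨y, η⟩ := z
  simp only at *
  set x := φ y with hx
  have hWx : W y = fderiv ℝ ψ x (W' x) := by simpa [hψφ] using h.self_of_nhds
  have hφ' := (hφ.differentiableAt (by simp)).hasFDerivAt
  have hψ' := (hψ.differentiableAt (by simp)).hasFDerivAt
  have hφ'' : HasFDerivAt φ (fderiv ℝ φ y) (ψ x) := by rwa [hψφ]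
  have hφψ' : fderiv ℝ φ y ∘L fderiv ℝ ψ x = ContinuousLinearMap.id ℝ E :=
    ((hφ''.comp x hψ').congr_of_eventuallyEq hφψ.symm).unique (hasFDerivAt_id x)
  have hbase : fderiv ℝ φ y (W y) = W' x := by
    rw [hWx]; exact DFunLike.congr_fun hφψ' (W' x)
  have hK := ((hψ.fderiv_right (m := ∞) (by simp)).differentiableAt (by simp)).hasFDerivAt
  set K := fderiv ℝ (fderiv ℝ ψ) x
  -- Differentiating `h` puts `W'` in the second slot of `K`, while differentiating the fibre
  -- coordinate along the lift puts it in the first. Symmetry makes the two agree.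
  have hsymm : ∀ u v, K u v = K v u :=
    (hψ.isSymmSndFDerivAt (by simpa using WithTop.coe_le_coe.2 (le_top : (2 : ℕ∞) ≤ ⊤)))
  -- differentiate the relation between the two vector fields
  have hDW : fderiv ℝ W y ∘L fderiv ℝ ψ x = K (W' x) + fderiv ℝ ψ x ∘L fderiv ℝ W' x := by
    have hW0 : HasFDerivAt W (fderiv ℝ W y) (ψ x) := by rw [hψφ]; exact hW.hasFDerivAt
    have h1 := hW0.comp x hψ'
    have h2 := (hK.clm_apply hW'.hasFDerivAt).congr_of_eventuallyEq h
    have h3 := h1.unique h2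
    rw [h3]
    ext v
    simp [hsymm v (W' x), add_comm]
  have hfst : HasFDerivAt (fun z : E × (E [⋀^Fin k]→L[ℝ] ℝ) => φ z.1)
      (fderiv ℝ φ y ∘L ContinuousLinearMap.fst ℝ E _) (y, η) :=
    HasFDerivAt.comp (y, η) (f := Prod.fst) hφ' (hasFDerivAt_fst (p := (y, η)))
  have hKz : HasFDerivAt (fun z : E × (E [⋀^Fin k]→L[ℝ] ℝ) => fderiv ℝ ψ (φ z.1))
      (K ∘L (fderiv ℝ φ y ∘L ContinuousLinearMap.fst ℝ E _)) (y, η) :=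
    HasFDerivAt.comp (y, η) (f := fun z : E × (E [⋀^Fin k]→L[ℝ] ℝ) => φ z.1) hK hfst
  have hsnd := (hasFDerivAt_snd (𝕜 := ℝ)
    (p := (y, η))).continuousAlternatingMapCompContinuousLinearMap hKz
  rw [(hfst.prodMk hsnd).fderiv]
  refine Prod.ext (by simpa [flatLift] using hbase) ?_
  ext v
  -- In the fibre component, the `K` terms from the coordinate change cancel those from `-DW`,
  -- leaving the action of `-DW'`.
  have hv (i : Fin k) : fderiv ℝ W y (fderiv ℝ ψ x (v i)) =
      K (W' x) (v i) + fderiv ℝ ψ x (fderiv ℝ W' x (v i)) := DFunLike.congr_fun hDW (v i)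
  have e1 : ∀ i, (fun j => (Function.update (fun _ : Fin k => fderiv ℝ ψ x) i (K (W' x)) j) (v j)) =
      Function.update (fun j => fderiv ℝ ψ x (v j)) i (K (W' x) (v i)) := by
    intro i; funext j; by_cases hj : j = i
    · subst hj; simp
    · simp [hj]
  have e2 : ∀ i, (fun j => fderiv ℝ ψ x (Function.update v i (fderiv ℝ W' x (v i)) j)) =
      Function.update (fun j => fderiv ℝ ψ x (v j)) i (fderiv ℝ ψ x (fderiv ℝ W' x (v i))) := by
    intro i; funext j; by_cases hj : j = i
    · subst hj; simp
    · simp [hj]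
  simp [flatLift, hbase, derivationAction_apply, Function.comp_def, hv, e1, e2, ← hx,
    Finset.sum_add_distrib]

end FlatPhaseSpace

/-! ### Nondegeneracy in linear coordinates. -/

section Nondegenerate

variable {E : Type*} [NormedAddCommGroup E] [NormedSpace ℝ E] {k : ℕ}

/-- New vectors are appended at the end, so `x` keeps position `0`. -/
theorem exists_linearIndependent_zero_eq {x : E} (hx : x ≠ 0) :
    ∀ {k : ℕ}, k + 1 ≤ Module.finrank ℝ E →
      ∃ u : Fin (k + 1) → E, LinearIndependent ℝ u ∧ u 0 = x
  | 0, _ => ⟨fun _ => x, LinearIndependent.of_subsingleton (ι := Fin 1) 0 hx, rfl⟩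
  | k + 1, h => by
    obtain ⟨u, hu, hu0⟩ := exists_linearIndependent_zero_eq hx (k := k) (by omega)
    obtain ⟨y, hy⟩ := exists_linearIndependent_snoc_of_lt_finrank hu (by omega)
    refine ⟨_, hy, ?_⟩
    rw [← hu0, ← Fin.castSucc_zero, Fin.snoc_castSucc]

variable [FiniteDimensional ℝ E]

/-- A nonzero vector is detected by alternating forms of degree at most the dimension. -/
theorem exists_curryLeft_ne_zero {x : E} (hx : x ≠ 0) (hk : k + 1 ≤ Module.finrank ℝ E) :
    ∃ ζ : E [⋀^Fin (k + 1)]→L[ℝ] ℝ, ζ.curryLeft x ≠ 0 := by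
  obtain ⟨u, hu, hu0⟩ := exists_linearIndependent_zero_eq hx hk
  -- A left inverse of the linear combination map provides coordinates dual to `u`. Their
  -- determinant is the desired form: it equals `1` on `u`, whose first vector is `x`.
  obtain ⟨g, hg⟩ := (Fintype.linearCombination ℝ u).exists_leftInverse_of_injective
    (LinearMap.ker_eq_bot.2 hu.fintypeLinearCombination_injective)
  let L : E →L[ℝ] (Fin (k + 1) → ℝ) := LinearMap.toContinuousLinearMap g
  have hL (i : Fin (k + 1)) : g (u i) = Pi.single i 1 := by
    have := DFunLike.congr_fun hg (Pi.single i 1)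
    simpa [Fintype.linearCombination_apply_single] using this
  let D : (Fin (k + 1) → ℝ) [⋀^Fin (k + 1)]→L[ℝ] ℝ :=
    { (Matrix.detRowAlternating : (Fin (k + 1) → ℝ) [⋀^Fin (k + 1)]→ₗ[ℝ] ℝ) with
      cont := Continuous.matrix_det continuous_id }
  refine ⟨D.compContinuousLinearMap L, fun h => ?_⟩
  have h1 := DFunLike.congr_fun h (Fin.tail u)
  have h2 : Matrix.vecCons x (Fin.tail u) = u := by
    rw [← hu0]; exact Fin.cons_self_tail u
  rw [curryLeft_apply_apply, h2] at h1
  have h3 : D.compContinuousLinearMap L u = Matrix.det (fun i => g (u i)) := rfl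
  rw [h3] at h1
  have h4 : (fun i => g (u i)) = (1 : Matrix (Fin (k + 1)) (Fin (k + 1)) ℝ) := by
    funext i
    rw [hL]
    funext j
    simp [Matrix.one_apply, Pi.single_apply, eq_comm]
  rw [h4, Matrix.det_one] at h1
  simp at h1

/-- Nondegeneracy of `β - dθ` on `E × Λ^{k+1} E^*`, where `θ` is the tautological form and `β` is
pulled back from the base. -/
theorem injective_curryLeft_flat (hk : k + 1 ≤ Module.finrank ℝ E)
    (z : E × (E [⋀^Fin (k + 1)]→L[ℝ] ℝ)) (β : E [⋀^Fin (k + 2)]→L[ℝ] ℝ) :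
    Function.Injective (curryLeft (-extDeriv (flatTautological E (k + 1)) z +
      β.compContinuousLinearMap (ContinuousLinearMap.fst ℝ E _))) := by
  rw [injective_iff_map_eq_zero]
  rintro ⟨x, ξ⟩ h
  have hx : x = 0 := by
    by_contra hx
    obtain ⟨ζ, hζ⟩ := exists_curryLeft_ne_zero hx hk
    refine hζ ?_
    ext u
    -- Test with one vertical vector, in slot `1`, and horizontal ones after it. The form `β`
    -- vanishes because slot `1` has no base component. In the alternating sum only `i = 1`
    -- survives: for `i = 0` the vertical vector is still an argument, and for `i ≥ 2` the fibre
    -- component is zero.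
    have h1 := DFunLike.congr_fun h (Matrix.vecCons ((0 : E), ζ) (fun j => (u j, 0)))
    have hz : ∀ (m : ℕ) (η : E [⋀^Fin (m + 1)]→L[ℝ] ℝ) (i : Fin (m + 1)) (v : Fin (m + 1) → E),
      v i = 0 → η v = 0 := fun m η i v hv => η.map_coord_zero i hv
    simp only [curryLeft_apply_apply, ContinuousAlternatingMap.add_apply,
      ContinuousAlternatingMap.neg_apply, extDeriv_flatTautological_apply,
      compContinuousLinearMap_apply] at h1
    rw [hz _ β 1 _ (by simp), Fin.sum_univ_succ, Fin.sum_univ_succ] at h1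
    rw [hz _ _ 0 _ (by simp [Fin.removeNth])] at h1
    simp only [Fin.val_zero, smul_zero, Matrix.cons_val_succ, zero_add, add_zero,
      ContinuousAlternatingMap.coe_zero, Pi.zero_apply, Finset.sum_const_zero, Matrix.cons_val_zero,
      Fin.val_succ, pow_one, neg_smul, one_smul, neg_neg] at h1
    rw [curryLeft_apply_apply, ContinuousAlternatingMap.coe_zero, Pi.zero_apply, ← h1]
    congr 1
    funext j
    refine Fin.cases ?_ (fun j => ?_) j <;> simp [Fin.removeNth]
  subst hx
  refine Prod.ext rfl ?_
  ext u
  -- Now slot `0` is vertical and all others are horizontal: `β` vanishes again and only the term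
  -- `ξ(u)` remains.
  have h1 := DFunLike.congr_fun h (fun j => (u j, 0))
  simp only [curryLeft_apply_apply, ContinuousAlternatingMap.add_apply,
      ContinuousAlternatingMap.neg_apply, extDeriv_flatTautological_apply,
      compContinuousLinearMap_apply] at h1
  rw [β.map_coord_zero (0 : Fin (k + 2)) (by simp), Fin.sum_univ_succ] at h1
  simpa [Fin.removeNth] using h1

end Nondegenerate

/-! ### Functoriality of the pullback. -/

section Pullback

variable {E H : Type*} [NormedAddCommGroup E] [NormedSpace ℝ E] [TopologicalSpace H]
  {I : ModelWithCorners ℝ E H} {M : Type*} [TopologicalSpace M] [ChartedSpace H M]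
  {E' H' : Type*} [NormedAddCommGroup E'] [NormedSpace ℝ E'] [TopologicalSpace H']
  {I' : ModelWithCorners ℝ E' H'} {M' : Type*} [TopologicalSpace M'] [ChartedSpace H' M']
  {E'' H'' : Type*} [NormedAddCommGroup E''] [NormedSpace ℝ E''] [TopologicalSpace H'']
  {I'' : ModelWithCorners ℝ E'' H''} {M'' : Type*} [TopologicalSpace M''] [ChartedSpace H'' M'']
  {k : ℕ}

theorem pullback_congr {f g : M → M'} {x : M} (h : f =ᶠ[𝓝 x] g) (α : DForm I' M' k) :
    pullback I I' f α x = pullback I I' g α x := by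
  -- The tangent spaces at `f x` and `g x` are different types; stated in the model space, the
  -- equality of the two points can be substituted.
  have key : ∀ (z z' : M') (A A' : E →L[ℝ] E'), z = z' → A = A' →
      (show E [⋀^Fin k]→L[ℝ] ℝ from
        (show E' [⋀^Fin k]→L[ℝ] ℝ from α z).compContinuousLinearMap A) =
      (show E' [⋀^Fin k]→L[ℝ] ℝ from α z').compContinuousLinearMap A' := by
    rintro z _ A _ rfl rfl
    rfl
  exact key _ _ _ _ h.self_of_nhds h.mfderiv_eq

theorem pullback_congr_form {f : M → M'} {x : M} {α β : DForm I' M' k} (h : α (f x) = β (f x)) :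
    pullback I I' f α x = pullback I I' f β x := by
  simp only [pullback, h]

theorem pullback_comp_apply {g : M' → M''} {f : M → M'} {x : M}
    (hg : MDifferentiableAt I' I'' g (f x)) (hf : MDifferentiableAt I I' f x)
    (α : DForm I'' M'' k) :
    pullback I I'' (g ∘ f) α x = pullback I I' f (pullback I' I'' g α) x := by
  simp only [pullback]
  rw [mfderiv_comp x hg hf]
  rfl

theorem pullback_id_apply (α : DForm I M k) (x : M) : pullback I I id α x = α x := by
  simp only [pullback, mfderiv_id]
  rfl

theorem pullback_flat (f : E → E') (α : DForm 𝓘(ℝ, E') E' k) (x : E) :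
    pullback 𝓘(ℝ, E) 𝓘(ℝ, E') f α x =
      (show E' [⋀^Fin k]→L[ℝ] ℝ from α (f x)).compContinuousLinearMap (fderiv ℝ f x) := by
  rw [pullback, mfderiv_eq_fderiv]
  rfl

end Pullback

/-! ### Forms and the exterior derivative in charts. -/

section Charts

variable {E H : Type*} [NormedAddCommGroup E] [NormedSpace ℝ E] [TopologicalSpace H]
  {I : ModelWithCorners ℝ E H} [I.Boundaryless]
  {M : Type*} [TopologicalSpace M] [ChartedSpace H M]
  {E' H' : Type*} [NormedAddCommGroup E'] [NormedSpace ℝ E'] [TopologicalSpace H']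
  {I' : ModelWithCorners ℝ E' H'} [I'.Boundaryless]
  {M' : Type*} [TopologicalSpace M'] [ChartedSpace H' M']
  {k : ℕ}

/-- Without boundary the model range is everything, so chart expressions are true pullbacks and
changes of chart follow from functoriality. -/
theorem chartForm_eq_pullback (x : M) (α : DForm I M k) :
    chartForm I x α = pullback 𝓘(ℝ, E) I (extChartAt I x).symm α := by
  funext y
  rw [chartForm, pullback, I.range_eq_univ, mfderivWithin_univ]
  rfl

theorem extD_eq_pullback (x : M) (α : DForm I M k) :
    extD I α x = pullback I 𝓘(ℝ, E) (extChartAt I x) (extDeriv (chartForm I x α)) x := by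
  rw [extD, I.range_eq_univ, extDerivWithin_univ]
  rfl

variable [IsManifold I ∞ M] [IsManifold I' ∞ M']

theorem mdifferentiableAt_chart_symm {x : M} {y : E} (hy : y ∈ (extChartAt I x).target) :
    MDifferentiableAt 𝓘(ℝ, E) I (extChartAt I x).symm y := by
  have : IsManifold I 1 M := .of_le (n := ∞) (by exact_mod_cast le_top)
  have h := mdifferentiableWithinAt_extChartAt_symm hy
  rwa [I.range_eq_univ, mdifferentiableWithinAt_univ] at h

theorem mdifferentiableAt_chart {x z : M} (hz : z ∈ (extChartAt I x).source) :
    MDifferentiableAt I 𝓘(ℝ, E) (extChartAt I x) z := by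
  have : IsManifold I 1 M := .of_le (n := ∞) (by exact_mod_cast le_top)
  exact mdifferentiableAt_extChartAt (by simpa using hz)

theorem contMDiffAt_chart_symm {x : M} {y : E} (hy : y ∈ (extChartAt I x).target) :
    ContMDiffAt 𝓘(ℝ, E) I ∞ (extChartAt I x).symm y :=
  (contMDiffOn_extChartAt_symm x).contMDiffAt ((isOpen_extChartAt_target x).mem_nhds hy)

theorem contMDiffAt_chart {x z : M} (hz : z ∈ (extChartAt I x).source) :
    ContMDiffAt I 𝓘(ℝ, E) ∞ (extChartAt I x) z :=
  contMDiffAt_extChartAt' (by simpa using hz)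

/-- The expression of a map in two charts. -/
theorem contDiffAt_inCharts {f : M → M'} {x : M} {x' : M'} {y : E}
    (hy : y ∈ (extChartAt I x).target)
    (hf : ContMDiffAt I I' ∞ f ((extChartAt I x).symm y))
    (hy' : f ((extChartAt I x).symm y) ∈ (extChartAt I' x').source) :
    ContDiffAt ℝ ∞ (extChartAt I' x' ∘ f ∘ (extChartAt I x).symm) y := by
  rw [← contMDiffAt_iff_contDiffAt]
  exact (contMDiffAt_chart hy').comp y (hf.comp y (contMDiffAt_chart_symm hy))

theorem eventually_mem_source_inCharts {f : M → M'} {x : M} {x' : M'} {y : E}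
    (hy : y ∈ (extChartAt I x).target)
    (hf : ContinuousAt f ((extChartAt I x).symm y))
    (hy' : f ((extChartAt I x).symm y) ∈ (extChartAt I' x').source) :
    ∀ᶠ y in 𝓝 y, y ∈ (extChartAt I x).target ∧
      f ((extChartAt I x).symm y) ∈ (extChartAt I' x').source := by
  have h : ContinuousAt (fun y => f ((extChartAt I x).symm y)) y :=
    ContinuousAt.comp (g := f) hf (contMDiffAt_chart_symm (I := I) hy).continuousAt
  exact ((isOpen_extChartAt_target x).mem_nhds hy |> eventually_mem_set.2).and
    (h.eventually_mem ((isOpen_extChartAt_source x').mem_nhds hy'))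

/-- Reading a pullback in charts. -/
theorem chartForm_pullback {f : M → M'} {x : M} {x' : M'} {y : E}
    (hy : y ∈ (extChartAt I x).target)
    (hf : ContMDiffAt I I' ∞ f ((extChartAt I x).symm y))
    (hy' : f ((extChartAt I x).symm y) ∈ (extChartAt I' x').source) (α : DForm I' M' k) :
    chartForm I x (pullback I I' f α) y =
      (chartForm I' x' α (extChartAt I' x' (f ((extChartAt I x).symm y)))).compContinuousLinearMap
        (fderiv ℝ (extChartAt I' x' ∘ f ∘ (extChartAt I x).symm) y) := by
  have h0 := pullback_comp_apply (hf.mdifferentiableAt (by simp))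
    (mdifferentiableAt_chart_symm hy) α
  -- Near `y` the map factors through its expression in the two charts, so `α` can be pulled back
  -- along either factorization.
  have h1 : f ∘ (extChartAt I x).symm =ᶠ[𝓝 y]
      (extChartAt I' x').symm ∘ (extChartAt I' x' ∘ f ∘ (extChartAt I x).symm) := by
    filter_upwards [eventually_mem_source_inCharts hy hf.continuousAt hy'] with z hz
    exact ((extChartAt I' x').left_inv hz.2).symm
  have h2 := pullback_comp_apply (f := extChartAt I' x' ∘ f ∘ (extChartAt I x).symm)
    (mdifferentiableAt_chart_symm ((extChartAt I' x').map_source hy'))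
    ((contDiffAt_inCharts hy hf hy').differentiableAt (by simp)).mdifferentiableAt α
  rw [chartForm_eq_pullback, chartForm_eq_pullback]
  exact h0.symm.trans ((pullback_congr h1 α).trans (h2.trans (pullback_flat _ _ _)))

/-- Change of charts for forms. -/
theorem chartForm_change {x x' : M} {y : E} (hy : y ∈ (extChartAt I x).target)
    (hy' : (extChartAt I x).symm y ∈ (extChartAt I x').source) (α : DForm I M k) :
    chartForm I x α y =
      (chartForm I x' α (extChartAt I x' ((extChartAt I x).symm y))).compContinuousLinearMap
        (fderiv ℝ (extChartAt I x' ∘ (extChartAt I x).symm) y) := by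
  have h := chartForm_pullback (f := id) hy contMDiffAt_id hy' α
  have h2 : pullback I I id α = α := funext (pullback_id_apply α)
  rw [h2] at h
  exact h

/-- The fibre coordinate of a form in the trivialization around `x` is its expression in the chart
around `x`. -/
theorem trivializationAt_snd_eq_chartForm {x z : M} (hz : z ∈ (extChartAt I x).source)
    (α : DForm I M k) :
    (trivializationAt (E [⋀^Fin k]→L[ℝ] ℝ)
      (fun x : M => TangentSpace I x [⋀^Fin k]→L[ℝ] ℝ) x ⟨z, α z⟩).2 =
      chartForm I x α (extChartAt I x z) := by
  have : IsManifold I 1 M := .of_le (n := ∞) (by exact_mod_cast le_top)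
  have hz' : z ∈ (chartAt H x).source := by simpa using hz
  have key : ∀ (z' : M) (A A' : E →L[ℝ] E), z' = z → A = A' →
      (show E [⋀^Fin k]→L[ℝ] ℝ from α z).compContinuousLinearMap A =
      (show E [⋀^Fin k]→L[ℝ] ℝ from α z').compContinuousLinearMap A' := by
    rintro _ A _ rfl rfl
    rfl
  refine Eq.trans ?_ (key _ _ _ ((extChartAt I x).left_inv hz)
    (TangentBundle.symmL_trivializationAt (𝕜 := ℝ) hz'))
  rw [FiberBundle.trivializationAt_continuousAlternatingMap_apply]
  ext v
  simp [inCoordinates]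
  rfl

/-- Smoothness of a section at `x` is that of its fibre coordinate in the trivialization at `x`,
which is the chart expression. Each chart is tested only at its centre. -/
theorem isSmoothForm_iff {α : DForm I M k} :
    IsSmoothForm I α ↔ ∀ x, ContDiffAt ℝ ∞ (chartForm I x α) (extChartAt I x x) := by
  have : IsManifold I 1 M := .of_le (n := ∞) (by exact_mod_cast le_top)
  refine forall_congr' fun x => ?_
  rw [contMDiffAt_section]
  have h1 : ContMDiffAt I 𝓘(ℝ, E [⋀^Fin k]→L[ℝ] ℝ) ∞
      (fun z => (trivializationAt (E [⋀^Fin k]→L[ℝ] ℝ)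
        (fun x : M => TangentSpace I x [⋀^Fin k]→L[ℝ] ℝ) x ⟨z, α z⟩).2) x ↔
      ContMDiffAt I 𝓘(ℝ, E [⋀^Fin k]→L[ℝ] ℝ) ∞
        (fun z => chartForm I x α (extChartAt I x z)) x := by
    refine Filter.EventuallyEq.contMDiffAt_iff ?_
    filter_upwards [extChartAt_source_mem_nhds (I := I) x] with z hz
    exact trivializationAt_snd_eq_chartForm hz α
  rw [h1]
  constructor
  · intro h
    have h2 : ContMDiffAt 𝓘(ℝ, E) 𝓘(ℝ, E [⋀^Fin k]→L[ℝ] ℝ) ∞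
        ((fun z => chartForm I x α (extChartAt I x z)) ∘ (extChartAt I x).symm)
        (extChartAt I x x) := by
      refine ContMDiffAt.comp (I' := I) _ ?_ (contMDiffAt_chart_symm (mem_extChartAt_target x))
      rwa [extChartAt_to_inv]
    rw [contMDiffAt_iff_contDiffAt] at h2
    refine h2.congr_of_eventuallyEq ?_
    filter_upwards [(isOpen_extChartAt_target x).mem_nhds (mem_extChartAt_target (I := I) x)]
      with y hy
    exact congrArg (chartForm I x α) ((extChartAt I x).right_inv hy).symm
  · intro h
    exact (contMDiffAt_iff_contDiffAt.2 h).comp x (contMDiffAt_chart (mem_extChartAt_source x))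

/-- Passes from the centre to any point of the chart, by comparison with the chart centred at that
point. -/
theorem IsSmoothForm.contDiffAt_chartForm {α : DForm I M k} (hα : IsSmoothForm I α) {x : M} {y : E}
    (hy : y ∈ (extChartAt I x).target) : ContDiffAt ℝ ∞ (chartForm I x α) y := by
  set z := (extChartAt I x).symm y with hz
  have h := (isSmoothForm_iff.1 hα) z
  have hy' : (extChartAt I x).symm y ∈ (extChartAt I z).source := mem_extChartAt_source z
  have hτ : ContDiffAt ℝ ∞ (extChartAt I z ∘ (extChartAt I x).symm) y :=
    contDiffAt_inCharts (f := id) hy contMDiffAt_id hy'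
  have h1 : chartForm I x α =ᶠ[𝓝 y] fun y =>
      (chartForm I z α ((extChartAt I z ∘ (extChartAt I x).symm) y)).compContinuousLinearMap
        (fderiv ℝ (extChartAt I z ∘ (extChartAt I x).symm) y) := by
    filter_upwards [eventually_mem_source_inCharts (f := id) hy continuousAt_id hy'] with u hu
    exact chartForm_change hu.1 hu.2 α
  refine ContDiffAt.congr_of_eventuallyEq ?_ h1
  exact contDiffAt_compContinuousLinearMap (ContDiffAt.comp (g := chartForm I z α) y h hτ)
    (hτ.fderiv_right (by simp))

theorem two_le_infty : minSmoothness ℝ 2 ≤ (∞ : WithTop ℕ∞) := by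
  simpa using WithTop.coe_le_coe.2 (le_top : (2 : ℕ∞) ≤ ⊤)

/-- The exterior derivative of the expression of a pullback in charts. -/
theorem extDeriv_chartForm_pullback {f : M → M'} {x : M} {x' : M'} {y : E}
    (hy : y ∈ (extChartAt I x).target) (hf : ContMDiff I I' ∞ f)
    (hy' : f ((extChartAt I x).symm y) ∈ (extChartAt I' x').source) {α : DForm I' M' k}
    (hα : IsSmoothForm I' α) :
    extDeriv (chartForm I x (pullback I I' f α)) y =
      (extDeriv (chartForm I' x' α)
        (extChartAt I' x' (f ((extChartAt I x).symm y)))).compContinuousLinearMap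
        (fderiv ℝ (extChartAt I' x' ∘ f ∘ (extChartAt I x).symm) y) := by
  have h1 : chartForm I x (pullback I I' f α) =ᶠ[𝓝 y] fun y =>
      (chartForm I' x' α ((extChartAt I' x' ∘ f ∘ (extChartAt I x).symm)
        y)).compContinuousLinearMap
        (fderiv ℝ (extChartAt I' x' ∘ f ∘ (extChartAt I x).symm) y) := by
    filter_upwards [eventually_mem_source_inCharts hy hf.continuous.continuousAt hy'] with u hu
    exact chartForm_pullback hu.1 hf.contMDiffAt hu.2 α
  rw [h1.extDeriv_eq, extDeriv_pullback _ (contDiffAt_inCharts hy hf.contMDiffAt hy') two_le_infty]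
  · rfl
  · exact (hα.contDiffAt_chartForm ((extChartAt I' x').map_source hy')).differentiableAt (by simp)

/-- The exterior derivative may be computed in any chart. -/
theorem extD_eq_pullback_chart {α : DForm I M k} (hα : IsSmoothForm I α) {x z : M}
    (hz : z ∈ (extChartAt I x).source) :
    extD I α z = pullback I 𝓘(ℝ, E) (extChartAt I x) (extDeriv (chartForm I x α)) z := by
  have h := extDeriv_chartForm_pullback (f := id) (x := z) (x' := x) (mem_extChartAt_target z)
    contMDiff_id (by simpa using hz) hα
  have h2 : pullback I I id α = α := funext (pullback_id_apply α)
  rw [h2] at h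
  have h3 : extDeriv (chartForm I z α) (extChartAt I z z) = pullback 𝓘(ℝ, E) 𝓘(ℝ, E)
      (extChartAt I x ∘ (extChartAt I z).symm) (extDeriv (chartForm I x α)) (extChartAt I z z) := by
    exact h.trans (pullback_flat (extChartAt I x ∘ (extChartAt I z).symm)
      (extDeriv (chartForm I x α)) (extChartAt I z z)).symm
  have h4 : ContDiffAt ℝ ∞ (extChartAt I x ∘ (extChartAt I z).symm) (extChartAt I z z) :=
    contDiffAt_inCharts (f := id) (mem_extChartAt_target z) contMDiffAt_id (by simpa using hz)
  have h5 := pullback_comp_apply (h4.differentiableAt (by simp)).mdifferentiableAt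
    (mdifferentiableAt_chart (mem_extChartAt_source (I := I) z)) (extDeriv (chartForm I x α))
  have h6 : (extChartAt I x ∘ (extChartAt I z).symm) ∘ extChartAt I z =ᶠ[𝓝 z] extChartAt I x := by
    filter_upwards [extChartAt_source_mem_nhds (I := I) z] with u hu
    exact congrArg (extChartAt I x) ((extChartAt I z).left_inv hu)
  exact (extD_eq_pullback z α).trans ((pullback_congr_form h3).trans
    (h5.symm.trans (pullback_congr h6 _)))

/-- The chart is fixed while the point varies over its whole target, so the exterior derivative can
be differentiated again. This underlies its smoothness and `d² = 0`. -/
theorem chartForm_extD {α : DForm I M k} (hα : IsSmoothForm I α) {x : M} {y : E}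
    (hy : y ∈ (extChartAt I x).target) :
    chartForm I x (extD I α) y = extDeriv (chartForm I x α) y := by
  have h1 := pullback_comp_apply (mdifferentiableAt_chart ((extChartAt I x).map_target hy))
    (mdifferentiableAt_chart_symm hy) (extDeriv (chartForm I x α))
  have h2 : extChartAt I x ∘ (extChartAt I x).symm =ᶠ[𝓝 y] id := by
    filter_upwards [(isOpen_extChartAt_target x).mem_nhds hy] with u hu
    exact (extChartAt I x).right_inv hu
  rw [chartForm_eq_pullback, pullback_congr_form
    (extD_eq_pullback_chart hα ((extChartAt I x).map_target hy))]
  exact h1.symm.trans ((pullback_congr h2 _).trans (pullback_id_apply _ _))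

theorem ofChart_chartForm (x : M) (α : DForm I M k) :
    ofChart I x (chartForm I x α (extChartAt I x x)) = α x := by
  have h : pullback I 𝓘(ℝ, E) (extChartAt I x) (chartForm I x α) x = α x := by
    rw [chartForm_eq_pullback, ← pullback_comp_apply]
    · have : (extChartAt I x).symm ∘ extChartAt I x =ᶠ[𝓝 x] id := by
        filter_upwards [extChartAt_source_mem_nhds (I := I) x] with u hu
        exact (extChartAt I x).left_inv hu
      rw [pullback_congr this, pullback_id_apply]
    · exact mdifferentiableAt_chart_symm (mem_extChartAt_target x)
    · exact mdifferentiableAt_chart (mem_extChartAt_source x)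
  exact h

theorem IsSmoothForm.extD {α : DForm I M k} (hα : IsSmoothForm I α) :
    IsSmoothForm I (extD I α) := by
  rw [isSmoothForm_iff]
  intro x
  refine (contDiffAt_extDeriv (hα.contDiffAt_chartForm
    (mem_extChartAt_target x))).congr_of_eventuallyEq ?_
  filter_upwards [(isOpen_extChartAt_target x).mem_nhds (mem_extChartAt_target (I := I) x)]
    with y hy using chartForm_extD hα hy

theorem IsSmoothForm.pullback {f : M → M'} (hf : ContMDiff I I' ∞ f) {α : DForm I' M' k}
    (hα : IsSmoothForm I' α) : IsSmoothForm I (pullback I I' f α) := by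
  rw [isSmoothForm_iff]
  intro x
  have hx : f ((extChartAt I x).symm (extChartAt I x x)) ∈ (extChartAt I' (f x)).source := by simp
  have hF := contDiffAt_inCharts (mem_extChartAt_target x) hf.contMDiffAt hx
  have h := hα.contDiffAt_chartForm ((extChartAt I' (f x)).map_source hx)
  refine (contDiffAt_compContinuousLinearMap
    (ContDiffAt.comp (f := extChartAt I' (f x) ∘ f ∘ (extChartAt I x).symm)
      (g := chartForm I' (f x) α) _ h hF) (hF.fderiv_right (by simp))).congr_of_eventuallyEq ?_
  filter_upwards [eventually_mem_source_inCharts (mem_extChartAt_target x)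
    hf.continuous.continuousAt hx] with u hu
  exact chartForm_pullback hu.1 hf.contMDiffAt hu.2 α

theorem extD_pullback {f : M → M'} (hf : ContMDiff I I' ∞ f) {α : DForm I' M' k}
    (hα : IsSmoothForm I' α) : extD I (pullback I I' f α) = pullback I I' f (extD I' α) := by
  funext x
  have hx : f ((extChartAt I x).symm (extChartAt I x x)) ∈ (extChartAt I' (f x)).source := by simp
  rw [extD, ← ofChart_chartForm x (Multisymplectic.pullback I I' f (Multisymplectic.extD I' α)),
    I.range_eq_univ, extDerivWithin_univ,
    extDeriv_chartForm_pullback (mem_extChartAt_target x) hf hx hα,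
    chartForm_pullback (mem_extChartAt_target x) hf.contMDiffAt hx,
    chartForm_extD hα ((extChartAt I' (f x)).map_source hx)]

theorem extD_extD {α : DForm I M k} (hα : IsSmoothForm I α) : extD I (extD I α) = 0 := by
  funext x
  have h : chartForm I x (extD I α) =ᶠ[𝓝 (extChartAt I x x)] extDeriv (chartForm I x α) := by
    filter_upwards [(isOpen_extChartAt_target x).mem_nhds (mem_extChartAt_target (I := I) x)]
      with y hy using chartForm_extD hα hy
  rw [extD, I.range_eq_univ, extDerivWithin_univ, h.extDeriv_eq,
    extDeriv_extDeriv_apply (hα.contDiffAt_chartForm (mem_extChartAt_target x)) two_le_infty]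
  rfl

theorem chartForm_add (x : M) (α β : DForm I M k) :
    chartForm I x (α + β) = chartForm I x α + chartForm I x β := rfl

theorem chartForm_neg (x : M) (α : DForm I M k) :
    chartForm I x (-α) = -chartForm I x α := rfl

theorem IsSmoothForm.add {α β : DForm I M k} (hα : IsSmoothForm I α) (hβ : IsSmoothForm I β) :
    IsSmoothForm I (α + β) :=
  isSmoothForm_iff.2 fun x => (isSmoothForm_iff.1 hα x).add (isSmoothForm_iff.1 hβ x)

theorem IsSmoothForm.neg {α : DForm I M k} (hα : IsSmoothForm I α) : IsSmoothForm I (-α) :=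
  isSmoothForm_iff.2 fun x => (isSmoothForm_iff.1 hα x).neg

theorem extD_add {α β : DForm I M k} (hα : IsSmoothForm I α) (hβ : IsSmoothForm I β) :
    extD I (α + β) = extD I α + extD I β := by
  funext x
  have h1 := (isSmoothForm_iff.1 hα x).differentiableAt (by simp)
  have h2 := (isSmoothForm_iff.1 hβ x).differentiableAt (by simp)
  simp only [extD, I.range_eq_univ, extDerivWithin_univ, chartForm_add, extDeriv_add h1 h2,
    Pi.add_apply]
  rfl

end Charts

/-! ### Vector fields, interior products and Lie derivatives in charts. -/

section Fields

variable {E H : Type*} [NormedAddCommGroup E] [NormedSpace ℝ E] [TopologicalSpace H]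
  {I : ModelWithCorners ℝ E H} [I.Boundaryless]
  {M : Type*} [TopologicalSpace M] [ChartedSpace H M] [IsManifold I ∞ M] {k : ℕ}

variable (I) in
/-- The components of a vector field in the chart around `x`, as a function on the manifold. -/
noncomputable def fieldComponents (x : M) (w : VField I M) : M → E :=
  fun z => mfderiv I 𝓘(ℝ, E) (extChartAt I x) z (w z)

theorem mfderiv_chart_comp_mfderiv_chart_symm {x : M} {y : E} (hy : y ∈ (extChartAt I x).target) :
    mfderiv I 𝓘(ℝ, E) (extChartAt I x) ((extChartAt I x).symm y) ∘L
      mfderivWithin 𝓘(ℝ, E) I (extChartAt I x).symm (range I) y = ContinuousLinearMap.id ℝ _ := by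
  have : IsManifold I 1 M := .of_le (n := ∞) (by exact_mod_cast le_top)
  exact mfderiv_extChartAt_comp_mfderivWithin_extChartAt_symm hy

theorem mfderiv_chart_symm_comp_mfderiv_chart {x : M} {y : E} (hy : y ∈ (extChartAt I x).target) :
    mfderivWithin 𝓘(ℝ, E) I (extChartAt I x).symm (range I) y ∘L
      mfderiv I 𝓘(ℝ, E) (extChartAt I x) ((extChartAt I x).symm y) =
    ContinuousLinearMap.id ℝ _ := by
  have : IsManifold I 1 M := .of_le (n := ∞) (by exact_mod_cast le_top)
  exact mfderivWithin_extChartAt_symm_comp_mfderiv_extChartAt hy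

/-- `chartField` inverts the derivative of the inverse chart; that inverse is the derivative of the
chart. -/
theorem chartField_eq_fieldComponents {x : M} {y : E} (hy : y ∈ (extChartAt I x).target)
    (w : VField I M) :
    chartField I x w y = fieldComponents I x w ((extChartAt I x).symm y) := by
  have h := ContinuousLinearMap.inverse_eq (mfderiv_chart_symm_comp_mfderiv_chart hy)
    (mfderiv_chart_comp_mfderiv_chart_symm hy)
  exact DFunLike.congr_fun h (w ((extChartAt I x).symm y))

theorem mfderiv_chart_symm_chartField {x : M} {y : E} (hy : y ∈ (extChartAt I x).target)
    (w : VField I M) :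
    mfderivWithin 𝓘(ℝ, E) I (extChartAt I x).symm (range I) y (chartField I x w y : E) =
      w ((extChartAt I x).symm y) := by
  rw [chartField_eq_fieldComponents hy]
  exact DFunLike.congr_fun (mfderiv_chart_symm_comp_mfderiv_chart hy) (w ((extChartAt I x).symm y))

/-- Change of charts for vector fields. -/
theorem chartField_change {x x' : M} {y : E} (hy : y ∈ (extChartAt I x).target)
    (hy' : (extChartAt I x).symm y ∈ (extChartAt I x').source) (w : VField I M) :
    fderiv ℝ (extChartAt I x' ∘ (extChartAt I x).symm) y (chartField I x w y) =
      chartField I x' w (extChartAt I x' ((extChartAt I x).symm y)) := by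
  rw [chartField_eq_fieldComponents ((extChartAt I x').map_source hy'),
    (extChartAt I x').left_inv hy', ← mfderiv_eq_fderiv]
  have h := mfderiv_comp y (mdifferentiableAt_chart hy') (mdifferentiableAt_chart_symm hy)
  have h2 := mfderiv_chart_symm_chartField hy w
  rw [I.range_eq_univ, mfderivWithin_univ] at h2
  refine (DFunLike.congr_fun h (chartField I x w y)).trans ?_
  exact congrArg (mfderiv I 𝓘(ℝ, E) (extChartAt I x') ((extChartAt I x).symm y)) h2

theorem isSmoothField_iff {w : VField I M} :
    IsSmoothField I w ↔ ∀ x, ContDiffAt ℝ ∞ (chartField I x w) (extChartAt I x x) := by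
  have : IsManifold I 1 M := .of_le (n := ∞) (by exact_mod_cast le_top)
  refine forall_congr' fun x => ?_
  refine (contMDiffAt_section x).trans ?_
  have h1 : ContMDiffAt I 𝓘(ℝ, E) ∞
      (fun z => (trivializationAt E (TangentSpace I : M → Type _) x ⟨z, w z⟩).2) x ↔
      ContMDiffAt I 𝓘(ℝ, E) ∞ (fun z => chartField I x w (extChartAt I x z)) x := by
    refine Filter.EventuallyEq.contMDiffAt_iff ?_
    filter_upwards [extChartAt_source_mem_nhds (I := I) x] with z hz
    have hz' : z ∈ (chartAt H x).source := by simpa using hz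
    rw [chartField_eq_fieldComponents ((extChartAt I x).map_source hz),
      (extChartAt I x).left_inv hz]
    have h := TangentBundle.continuousLinearMapAt_trivializationAt (𝕜 := ℝ) (I := I) hz'
    refine Eq.trans ?_ (DFunLike.congr_fun h (w z))
    rw [Trivialization.continuousLinearMapAt_apply, Trivialization.linearMapAt_apply,
      if_pos (by simpa using hz')]
  rw [h1]
  constructor
  · intro h
    have h2 : ContMDiffAt 𝓘(ℝ, E) 𝓘(ℝ, E) ∞
        ((fun z => chartField I x w (extChartAt I x z)) ∘ (extChartAt I x).symm)
        (extChartAt I x x) := by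
      refine ContMDiffAt.comp (I' := I) _ ?_ (contMDiffAt_chart_symm (mem_extChartAt_target x))
      rwa [extChartAt_to_inv]
    rw [contMDiffAt_iff_contDiffAt] at h2
    refine h2.congr_of_eventuallyEq ?_
    filter_upwards [(isOpen_extChartAt_target x).mem_nhds (mem_extChartAt_target (I := I) x)]
      with y hy
    exact congrArg (chartField I x w) ((extChartAt I x).right_inv hy).symm
  · intro h
    exact (contMDiffAt_iff_contDiffAt.2 h).comp x (contMDiffAt_chart (mem_extChartAt_source x))

theorem IsSmoothField.contDiffAt_chartField {w : VField I M} (hw : IsSmoothField I w) {x : M}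
    {y : E} (hy : y ∈ (extChartAt I x).target) : ContDiffAt ℝ ∞ (chartField I x w) y := by
  set z := (extChartAt I x).symm y with hz
  have h := (isSmoothField_iff.1 hw) z
  have hyz : (extChartAt I x).symm y ∈ (extChartAt I z).source := mem_extChartAt_source z
  have hzx : z ∈ (extChartAt I x).source := (extChartAt I x).map_target hy
  have hzx' : (extChartAt I z).symm (extChartAt I z z) ∈ (extChartAt I x).source := by
    simpa using hzx
  have hτ : ContDiffAt ℝ ∞ (extChartAt I z ∘ (extChartAt I x).symm) y :=
    contDiffAt_inCharts (f := id) hy contMDiffAt_id hyz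
  have hσ : ContDiffAt ℝ ∞ (extChartAt I x ∘ (extChartAt I z).symm)
      ((extChartAt I z ∘ (extChartAt I x).symm) y) :=
    contDiffAt_inCharts (f := id) (mem_extChartAt_target z) contMDiffAt_id hzx'
  have h1 : chartField I x w =ᶠ[𝓝 y] fun y =>
      fderiv ℝ (extChartAt I x ∘ (extChartAt I z).symm)
        ((extChartAt I z ∘ (extChartAt I x).symm) y)
        (chartField I z w ((extChartAt I z ∘ (extChartAt I x).symm) y)) := by
    filter_upwards [eventually_mem_source_inCharts (f := id) hy continuousAt_id hyz] with u hu
    have hu1 : (extChartAt I z).symm (extChartAt I z ((extChartAt I x).symm u)) =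
        (extChartAt I x).symm u := (extChartAt I z).left_inv hu.2
    have h2 := chartField_change (x := z) (x' := x) ((extChartAt I z).map_source hu.2)
      (by rw [id, hu1]; exact (extChartAt I x).map_target hu.1) w
    rw [id, hu1, (extChartAt I x).right_inv hu.1] at h2
    exact h2.symm
  refine ContDiffAt.congr_of_eventuallyEq ?_ h1
  refine ContDiffAt.clm_apply ?_ (ContDiffAt.comp (g := chartField I z w) y h hτ)
  exact ContDiffAt.comp (g := fderiv ℝ (extChartAt I x ∘ (extChartAt I z).symm)) y
    (hσ.fderiv_right (by simp)) hτ

theorem chartForm_interior {x : M} {y : E} (hy : y ∈ (extChartAt I x).target) (w : VField I M)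
    (α : DForm I M (k + 1)) :
    chartForm I x (interior I w α) y = (chartForm I x α y).curryLeft (chartField I x w y) := by
  ext v
  have h := mfderiv_chart_symm_chartField hy w
  refine congrArg (α ((extChartAt I x).symm y)) (funext fun j => ?_)
  refine Fin.cases ?_ (fun j => ?_) j
  · exact h.symm
  · rfl

theorem IsSmoothForm.interior {w : VField I M} (hw : IsSmoothField I w) {α : DForm I M (k + 1)}
    (hα : IsSmoothForm I α) : IsSmoothForm I (interior I w α) := by
  rw [isSmoothForm_iff]
  intro x
  refine (contDiffAt_curryLeft (hα.contDiffAt_chartForm (mem_extChartAt_target x))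
    (hw.contDiffAt_chartField (mem_extChartAt_target x))).congr_of_eventuallyEq ?_
  filter_upwards [(isOpen_extChartAt_target x).mem_nhds (mem_extChartAt_target (I := I) x)]
    with y hy using chartForm_interior hy w α

/-- Only the value at `x` matters, so `α` may be replaced by the pullback under the chart of the
constant form `η`. -/
theorem chartForm_ofChart {α : DForm I M k} {x : M} {η : E [⋀^Fin k]→L[ℝ] ℝ}
    (h : α x = ofChart I x η) : chartForm I x α (extChartAt I x x) = η := by
  have h1 := chartForm_eq_pullback (I := I) x α
  have h0 : α ((extChartAt I x).symm (extChartAt I x x)) =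
      Multisymplectic.pullback I 𝓘(ℝ, E) (extChartAt I x) (fun _ => η)
        ((extChartAt I x).symm (extChartAt I x x)) := by
    rw [extChartAt_to_inv]
    exact h
  rw [h1, pullback_congr_form h0]
  refine (pullback_comp_apply (mdifferentiableAt_chart (by simp))
    (mdifferentiableAt_chart_symm (mem_extChartAt_target x)) (fun _ => η)).symm.trans ?_
  have h2 : extChartAt I x ∘ (extChartAt I x).symm =ᶠ[𝓝 (extChartAt I x x)] id := by
    filter_upwards [(isOpen_extChartAt_target x).mem_nhds (mem_extChartAt_target (I := I) x)]
      with u hu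
    exact (extChartAt I x).right_inv hu
  exact (pullback_congr h2 _).trans (pullback_id_apply _ _)

/-- The centre of the chart suffices, because Lie derivatives are only compared pointwise and never
differentiated. -/
theorem chartForm_lieD_self (w : VField I M) (α : DForm I M k) (x : M) :
    chartForm I x (lieD I w α) (extChartAt I x x) =
      fderiv ℝ (chartForm I x α) (extChartAt I x x) (chartField I x w (extChartAt I x x)) +
      derivationAction (fderiv ℝ (chartField I x w) (extChartAt I x x))
        (chartForm I x α (extChartAt I x x)) := by
  refine chartForm_ofChart ?_
  rw [lieD, I.range_eq_univ, fderivWithin_univ, fderivWithin_univ]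

theorem DForm.ext_chartForm {α β : DForm I M k}
    (h : ∀ x, chartForm I x α (extChartAt I x x) = chartForm I x β (extChartAt I x x)) :
    α = β := by
  funext x
  rw [← ofChart_chartForm x α, h, ofChart_chartForm]

end Fields

/-! ### The Cartan formula on a manifold. -/

section Cartan

variable {E H : Type*} [NormedAddCommGroup E] [NormedSpace ℝ E] [TopologicalSpace H]
  {I : ModelWithCorners ℝ E H} [I.Boundaryless]
  {M : Type*} [TopologicalSpace M] [ChartedSpace H M] [IsManifold I ∞ M] {k : ℕ}

/-- The Cartan formula. -/
theorem extD_interior_add_interior_extD {w : VField I M} (hw : IsSmoothField I w)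
    {α : DForm I M (k + 1)} (hα : IsSmoothForm I α) :
    extD I (interior I w α) + interior I w (extD I α) = lieD I w α := by
  refine DForm.ext_chartForm fun x => ?_
  have hx := mem_extChartAt_target (I := I) x
  have h : chartForm I x (interior I w α) =ᶠ[𝓝 (extChartAt I x x)]
      fun y => (chartForm I x α y).curryLeft (chartField I x w y) := by
    filter_upwards [(isOpen_extChartAt_target x).mem_nhds hx]
      with y hy using chartForm_interior hy w α
  rw [chartForm_add, Pi.add_apply, chartForm_extD (hα.interior hw) hx, chartForm_interior hx,
    chartForm_extD hα hx, h.extDeriv_eq, chartForm_lieD_self]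
  exact extDeriv_curryLeft_add_curryLeft_extDeriv
    ((hα.contDiffAt_chartForm hx).differentiableAt (by simp))
    ((hw.contDiffAt_chartField hx).differentiableAt (by simp))

theorem lieD_add {w : VField I M} {α β : DForm I M k} (hα : IsSmoothForm I α)
    (hβ : IsSmoothForm I β) : lieD I w (α + β) = lieD I w α + lieD I w β := by
  refine DForm.ext_chartForm fun x => ?_
  have h1 := (isSmoothForm_iff.1 hα x).differentiableAt (by simp)
  have h2 := (isSmoothForm_iff.1 hβ x).differentiableAt (by simp)
  rw [chartForm_add, Pi.add_apply, chartForm_lieD_self, chartForm_lieD_self, chartForm_lieD_self,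
    chartForm_add, fderiv_add h1 h2]
  ext v
  simp only [_root_.add_apply, ContinuousAlternatingMap.add_apply,
    derivationAction_apply, Pi.add_apply, Finset.sum_add_distrib]
  ring

end Cartan

/-! ### Bundle charts of `Λ^k T^*N`, the canonical lift and the magnetic form. -/

section BundleCharts

variable {E H : Type*} [NormedAddCommGroup E] [NormedSpace ℝ E] [TopologicalSpace H]
  {I : ModelWithCorners ℝ E H} [I.Boundaryless]
  {N : Type*} [TopologicalSpace N] [ChartedSpace H N] [IsManifold I ∞ N] {k m : ℕ}

theorem mem_formBundle_chart_source {p q : FormBundle I N k} :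
    q ∈ (extChartAt (formModel I k) p).source ↔ q.proj ∈ (extChartAt I p.proj).source := by
  rw [extChartAt_source, extChartAt_source, FiberBundle.chartedSpace_chartAt]
  simp only [mfld_simps]
  exact ⟨fun h => h.1.1, fun h => ⟨⟨h, mem_univ _⟩, h⟩⟩

theorem mem_formBundle_chart_target {p : FormBundle I N k} {z : E × (E [⋀^Fin k]→L[ℝ] ℝ)} :
    z ∈ (extChartAt (formModel I k) p).target ↔ z.1 ∈ (extChartAt I p.proj).target := by
  rw [FiberBundle.extChartAt_target]
  constructor
  · exact fun h => h.1.1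
  · intro h
    refine ⟨⟨h, ?_⟩, mem_univ _⟩
    have := (extChartAt I p.proj).map_target h
    rw [extChartAt_source] at this
    exact ⟨by simpa using this, mem_univ _⟩

/-- The coordinates of `q`, in terms of a form on the base whose value at `π q` is `q`. -/
theorem formBundle_chart_apply {p q : FormBundle I N k}
    (hq : q.proj ∈ (extChartAt I p.proj).source) {α : DForm I N k} (hα : α q.proj = q.2) :
    extChartAt (formModel I k) p q =
      (extChartAt I p.proj q.proj, chartForm I p.proj α (extChartAt I p.proj q.proj)) := by
  rw [← trivializationAt_snd_eq_chartForm hq α, hα, FiberBundle.extChartAt]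
  rfl

/-- The form is zero away from one point and need not be smooth. It lets pointwise facts about forms
on the base be applied to points of the bundle. -/
theorem exists_form_apply_eq (q : FormBundle I N k) : ∃ α : DForm I N k, α q.proj = q.2 := by
  classical
  exact ⟨Function.update (fun _ => 0) q.proj q.2, Function.update_self ..⟩

theorem formBundle_chart_fst {p q : FormBundle I N k}
    (hq : q.proj ∈ (extChartAt I p.proj).source) :
    (extChartAt (formModel I k) p q).1 = extChartAt I p.proj q.proj := by
  obtain ⟨α, hα⟩ := exists_form_apply_eq q
  rw [formBundle_chart_apply hq hα]

theorem proj_formBundle_chart_symm {p : FormBundle I N k} {z : E × (E [⋀^Fin k]→L[ℝ] ℝ)}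
    (hz : z ∈ (extChartAt (formModel I k) p).target) :
    ((extChartAt (formModel I k) p).symm z).proj = (extChartAt I p.proj).symm z.1 := by
  have h := mem_formBundle_chart_source.1 ((extChartAt (formModel I k) p).map_target hz)
  have h1 := formBundle_chart_fst h
  rw [(extChartAt (formModel I k) p).right_inv hz] at h1
  rw [h1, (extChartAt I p.proj).left_inv h]

theorem chartForm_eq_snd {p : FormBundle I N k} {z : E × (E [⋀^Fin k]→L[ℝ] ℝ)}
    (hz : z ∈ (extChartAt (formModel I k) p).target) {α : DForm I N k}
    (hα : α ((extChartAt (formModel I k) p).symm z).proj =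
      ((extChartAt (formModel I k) p).symm z).2) :
    chartForm I p.proj α z.1 = z.2 := by
  have h := mem_formBundle_chart_source.1 ((extChartAt (formModel I k) p).map_target hz)
  have h1 := formBundle_chart_apply h hα
  rw [(extChartAt (formModel I k) p).right_inv hz] at h1
  have h2 := congrArg Prod.fst h1
  have h3 := congrArg Prod.snd h1
  simp only at h2 h3
  rw [← h2] at h3
  exact h3.symm

theorem contMDiff_formBundle_proj : ContMDiff (formModel I k) I ∞ (proj I N k) :=
  contMDiff_proj _

/-- In a bundle chart and the base chart below it, `π` reads as the first projection. -/
theorem chartForm_pullback_proj {p : FormBundle I N k} {z : E × (E [⋀^Fin k]→L[ℝ] ℝ)}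
    (hz : z ∈ (extChartAt (formModel I k) p).target) (α : DForm I N m) :
    chartForm (formModel I k) p (pullback (formModel I k) I (proj I N k) α) z =
      (chartForm I p.proj α z.1).compContinuousLinearMap
        (ContinuousLinearMap.fst ℝ E (E [⋀^Fin k]→L[ℝ] ℝ)) := by
  have h0 : proj I N k ((extChartAt (formModel I k) p).symm z) ∈ (extChartAt I p.proj).source :=
    mem_formBundle_chart_source.1 ((extChartAt (formModel I k) p).map_target hz)
  have h1 : ∀ u ∈ (extChartAt (formModel I k) p).target,
      extChartAt I p.proj (proj I N k ((extChartAt (formModel I k) p).symm u)) = u.1 := by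
    intro u hu
    rw [proj, proj_formBundle_chart_symm hu,
      (extChartAt I p.proj).right_inv (mem_formBundle_chart_target.1 hu)]
  have h2 : extChartAt I p.proj ∘ proj I N k ∘ (extChartAt (formModel I k) p).symm =ᶠ[𝓝 z]
      Prod.fst := by
    filter_upwards [(isOpen_extChartAt_target p).mem_nhds hz] with u hu using h1 u hu
  rw [chartForm_pullback hz contMDiff_formBundle_proj.contMDiffAt h0, h1 z hz, h2.fderiv_eq,
    fderiv_fst]

theorem chartForm_congr {M : Type*} [TopologicalSpace M] [ChartedSpace H M] {x : M} {y : E}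
    {α β : DForm I M k}
    (h : α ((extChartAt I x).symm y) = β ((extChartAt I x).symm y)) :
    chartForm I x α y = chartForm I x β y := by
  simp only [chartForm, h]

/-- At a point `q` the tautological form equals `π^*α` for any `α` with value `q` at `π q`, and the
chart expression at a point depends only on the value there. -/
theorem chartForm_tautologicalForm {p : FormBundle I N k} {z : E × (E [⋀^Fin k]→L[ℝ] ℝ)}
    (hz : z ∈ (extChartAt (formModel I k) p).target) :
    chartForm (formModel I k) p (tautologicalForm I N k) z = flatTautological E k z := by
  obtain ⟨α, hα⟩ := exists_form_apply_eq ((extChartAt (formModel I k) p).symm z)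
  have h : tautologicalForm I N k ((extChartAt (formModel I k) p).symm z) =
      pullback (formModel I k) I (proj I N k) α ((extChartAt (formModel I k) p).symm z) := by
    rw [tautologicalForm, pullback, proj, hα]
  rw [chartForm_congr h, chartForm_pullback_proj hz, chartForm_eq_snd hz hα]
  rfl

theorem chartForm_theta {p : FormBundle I N k} {z : E × (E [⋀^Fin k]→L[ℝ] ℝ)}
    (hz : z ∈ (extChartAt (formModel I k) p).target) :
    chartForm (formModel I k) p (theta I N k) z = -flatTautological E k z := by
  rw [theta, chartForm_neg, Pi.neg_apply, chartForm_tautologicalForm hz]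

theorem chartForm_theta_eventuallyEq {p : FormBundle I N k} {z : E × (E [⋀^Fin k]→L[ℝ] ℝ)}
    (hz : z ∈ (extChartAt (formModel I k) p).target) :
    chartForm (formModel I k) p (theta I N k) =ᶠ[𝓝 z] fun z => -flatTautological E k z := by
  filter_upwards [(isOpen_extChartAt_target p).mem_nhds hz] with u hu using chartForm_theta hu

theorem contDiff_flatTautological : ContDiff ℝ ∞ (flatTautological E k) := by
  exact ContinuousLinearMap.contDiff (𝕜 := ℝ) (E := E × (E [⋀^Fin k]→L[ℝ] ℝ))
    (F := (E × (E [⋀^Fin k]→L[ℝ] ℝ)) [⋀^Fin k]→L[ℝ] ℝ) _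

theorem isSmoothForm_theta : IsSmoothForm (formModel I k) (theta I N k) := by
  rw [isSmoothForm_iff]
  intro p
  exact contDiff_flatTautological.neg.contDiffAt.congr_of_eventuallyEq
    (chartForm_theta_eventuallyEq (mem_extChartAt_target p))

/-- The coordinate changes of `Λ^k T^*N`. -/
theorem formBundle_chart_change {p q : FormBundle I N k} {z : E × (E [⋀^Fin k]→L[ℝ] ℝ)}
    (hz : z ∈ (extChartAt (formModel I k) q).target)
    (hz' : (extChartAt I q.proj).symm z.1 ∈ (extChartAt I p.proj).source) :
    extChartAt (formModel I k) p ((extChartAt (formModel I k) q).symm z) =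
      ((extChartAt I p.proj ∘ (extChartAt I q.proj).symm) z.1,
        z.2.compContinuousLinearMap (fderiv ℝ (extChartAt I q.proj ∘ (extChartAt I p.proj).symm)
          ((extChartAt I p.proj ∘ (extChartAt I q.proj).symm) z.1))) := by
  obtain ⟨α, hα⟩ := exists_form_apply_eq ((extChartAt (formModel I k) q).symm z)
  have h1 := proj_formBundle_chart_symm hz
  have hz1 := mem_formBundle_chart_target.1 hz
  rw [formBundle_chart_apply (by rwa [h1]) hα, h1,
    chartForm_change (x := p.proj) (x' := q.proj) ((extChartAt I p.proj).map_source hz')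
      (by rw [(extChartAt I p.proj).left_inv hz']; exact (extChartAt I q.proj).map_target hz1),
    (extChartAt I p.proj).left_inv hz', (extChartAt I q.proj).right_inv hz1,
    chartForm_eq_snd hz hα]
  rfl

/-- The canonical lift in the chart around the point. -/
theorem chartField_canonicalLift_self (w : VField I N) (q : FormBundle I N k) :
    chartField (formModel I k) q (canonicalLift I k w) (extChartAt (formModel I k) q q) =
      flatLift (chartField I q.proj w) (extChartAt (formModel I k) q q) := by
  have hq := mem_extChartAt_target (I := formModel I k) q
  rw [chartField_eq_fieldComponents hq, extChartAt_to_inv]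
  have h1 := mfderiv_chart_comp_mfderiv_chart_symm hq
  rw [extChartAt_to_inv] at h1
  have h2 : canonicalLift I k w q =
      mfderivWithin 𝓘(ℝ, E × (E [⋀^Fin k]→L[ℝ] ℝ)) (formModel I k)
        (extChartAt (formModel I k) q).symm (range (formModel I k))
        (extChartAt (formModel I k) q q)
        (flatLift (chartField I q.proj w) (extChartAt (formModel I k) q q) :
          E × (E [⋀^Fin k]→L[ℝ] ℝ)) := by
    simp only [canonicalLift, I.range_eq_univ, fderivWithin_univ]
    rfl
  refine (congrArg (mfderiv (formModel I k) 𝓘(ℝ, E × (E [⋀^Fin k]→L[ℝ] ℝ))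
    (extChartAt (formModel I k) q) q) h2).trans ?_
  exact DFunLike.congr_fun h1 (flatLift (chartField I q.proj w) (extChartAt (formModel I k) q q))

/-- The canonical lift in any bundle chart. -/
theorem chartField_canonicalLift {w : VField I N} (hw : IsSmoothField I w) {p : FormBundle I N k}
    {z : E × (E [⋀^Fin k]→L[ℝ] ℝ)} (hz : z ∈ (extChartAt (formModel I k) p).target) :
    chartField (formModel I k) p (canonicalLift I k w) z = flatLift (chartField I p.proj w) z := by
  -- The lift at `q` is defined in the chart centred at `q`; its expression there is carried to the
  -- chart around `p` by the coordinate change.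
  obtain ⟨q, hq, rfl⟩ : ∃ q, q ∈ (extChartAt (formModel I k) p).source ∧
      extChartAt (formModel I k) p q = z :=
    ⟨_, (extChartAt (formModel I k) p).map_target hz, (extChartAt (formModel I k) p).right_inv hz⟩
  have hqp := mem_formBundle_chart_source.1 hq
  have hqt := mem_extChartAt_target (I := formModel I k) q
  have hq1 : (extChartAt (formModel I k) q q).1 = extChartAt I q.proj q.proj :=
    formBundle_chart_fst (mem_extChartAt_source q.proj)
  have hqs : (extChartAt I q.proj).symm (extChartAt (formModel I k) q q).1 = q.proj := by
    rw [hq1, extChartAt_to_inv]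
  have h1 := chartField_change (I := formModel I k) (x := q) (x' := p) hqt
    (by rwa [extChartAt_to_inv]) (canonicalLift I k w)
  rw [extChartAt_to_inv, chartField_canonicalLift_self] at h1
  rw [← h1]
  set c := extChartAt (formModel I k) q q
  have hτ : extChartAt (formModel I k) p ∘ (extChartAt (formModel I k) q).symm =ᶠ[𝓝 c]
      fun z => ((extChartAt I p.proj ∘ (extChartAt I q.proj).symm) z.1,
        z.2.compContinuousLinearMap (fderiv ℝ (extChartAt I q.proj ∘ (extChartAt I p.proj).symm)
          ((extChartAt I p.proj ∘ (extChartAt I q.proj).symm) z.1))) := by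
    have hev := (continuous_fst.continuousAt (x := c)).eventually
      (eventually_mem_source_inCharts (f := id) (x' := p.proj) (mem_formBundle_chart_target.1 hqt)
        continuousAt_id (by rw [id, hqs]; exact hqp))
    filter_upwards [hev] with u hu
    exact formBundle_chart_change (mem_formBundle_chart_target.2 hu.1) hu.2
  have hφ0 : (extChartAt I p.proj ∘ (extChartAt I q.proj).symm) c.1 =
      extChartAt I p.proj q.proj := by rw [Function.comp_apply, hqs]
  have hpt : extChartAt I p.proj q.proj ∈ (extChartAt I p.proj).target :=
    (extChartAt I p.proj).map_source hqp
  have hps : (extChartAt I p.proj).symm (extChartAt I p.proj q.proj) = q.proj :=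
    (extChartAt I p.proj).left_inv hqp
  have hev : ∀ᶠ y in 𝓝 (extChartAt I p.proj q.proj), y ∈ (extChartAt I p.proj).target ∧
      id ((extChartAt I p.proj).symm y) ∈ (extChartAt I q.proj).source :=
    eventually_mem_source_inCharts (f := id) hpt continuousAt_id
      (by rw [id, hps]; exact mem_extChartAt_source q.proj)
  have hτc : extChartAt (formModel I k) p q = _ :=
    (congrArg (extChartAt (formModel I k) p) (extChartAt_to_inv q)).symm.trans hτ.self_of_nhds
  rw [hτ.fderiv_eq, hτc]
  -- Here `φ` is the base transition from the chart at `π q` to the chart at `π p` and `ψ` is the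
  -- reverse transition; `W` and `W'` are `w` in these charts.
  refine fderiv_apply_flatLift ?_ ?_ ?_ ?_ ?_ ?_ ?_
  · exact contDiffAt_inCharts (f := id) (mem_formBundle_chart_target.1 hqt) contMDiffAt_id
      (by rw [id, hqs]; exact hqp)
  · rw [hφ0]
    exact contDiffAt_inCharts (f := id) hpt contMDiffAt_id
      (by rw [id, hps]; exact mem_extChartAt_source q.proj)
  · rw [hφ0, Function.comp_apply, hps, hq1]
  · rw [hφ0]
    filter_upwards [hev] with y hy
    exact (congrArg (extChartAt I p.proj) ((extChartAt I q.proj).left_inv hy.2)).trans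
      ((extChartAt I p.proj).right_inv hy.1)
  · exact (hw.contDiffAt_chartField (mem_formBundle_chart_target.1 hqt)).differentiableAt (by simp)
  · rw [hφ0]
    exact (hw.contDiffAt_chartField hpt).differentiableAt (by simp)
  · rw [hφ0]
    filter_upwards [hev] with y hy
    exact (chartField_change hy.1 hy.2 w).symm

theorem isSmoothField_canonicalLift {w : VField I N} (hw : IsSmoothField I w) :
    IsSmoothField (formModel I k) (canonicalLift I k w) := by
  rw [isSmoothField_iff]
  intro p
  have hp := mem_extChartAt_target (I := formModel I k) p
  refine (contDiffAt_flatLift (hw.contDiffAt_chartField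
    (mem_formBundle_chart_target.1 hp))).congr_of_eventuallyEq ?_
  filter_upwards [(isOpen_extChartAt_target p).mem_nhds hp] with u hu
    using chartField_canonicalLift hw hu

theorem chartField_canonicalLift_eventuallyEq {w : VField I N} (hw : IsSmoothField I w)
    {p : FormBundle I N k} {z : E × (E [⋀^Fin k]→L[ℝ] ℝ)}
    (hz : z ∈ (extChartAt (formModel I k) p).target) :
    chartField (formModel I k) p (canonicalLift I k w) =ᶠ[𝓝 z]
      flatLift (chartField I p.proj w) := by
  filter_upwards [(isOpen_extChartAt_target p).mem_nhds hz] with u hu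
    using chartField_canonicalLift hw hu

theorem fderiv_neg_form {V : Type*} [NormedAddCommGroup V] [NormedSpace ℝ V]
    (α : V → V [⋀^Fin k]→L[ℝ] ℝ) (x : V) : fderiv ℝ (fun y => -α y) x = -fderiv ℝ α x :=
  fderiv_fun_neg

theorem extDeriv_neg {V : Type*} [NormedAddCommGroup V] [NormedSpace ℝ V]
    (α : V → V [⋀^Fin k]→L[ℝ] ℝ) (x : V) : extDeriv (fun y => -α y) x = -extDeriv α x := by
  rw [extDeriv, fderiv_neg_form]
  exact map_neg (alternatizeUncurryFinCLM ℝ V ℝ) _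

/-- The canonical lift preserves the tautological form. -/
theorem lieD_canonicalLift_theta {w : VField I N} (hw : IsSmoothField I w) :
    lieD (formModel I k) (canonicalLift I k w) (theta I N k) = 0 := by
  refine DForm.ext_chartForm fun p => ?_
  have hp := mem_extChartAt_target (I := formModel I k) p
  have hW := hw.contDiffAt_chartField (mem_formBundle_chart_target.1 hp)
  have h0 : chartForm (k := k) (formModel I k) p 0 (extChartAt (formModel I k) p p) = 0 := rfl
  rw [h0, chartForm_lieD_self, (chartForm_theta_eventuallyEq hp).fderiv_eq, chartForm_theta hp,
    (chartField_canonicalLift_eventuallyEq hw hp).fderiv_eq, chartField_canonicalLift hw hp,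
    fderiv_neg_form]
  have h := lie_flatLift_flatTautological (k := k) hW
  ext v
  have h' := DFunLike.congr_fun h v
  simp only [ContinuousAlternatingMap.add_apply, derivationAction_apply,
    _root_.neg_apply, ContinuousAlternatingMap.neg_apply, Finset.sum_neg_distrib,
    ContinuousAlternatingMap.coe_zero, Pi.zero_apply] at h' ⊢
  linarith

/-- The Lie derivative along the canonical lift of a form pulled back from the base. -/
theorem lieD_canonicalLift_pullback {w : VField I N} (hw : IsSmoothField I w) {b : DForm I N m}
    (hb : IsSmoothForm I b) :
    lieD (formModel I k) (canonicalLift I k w) (pullback (formModel I k) I (proj I N k) b) =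
      pullback (formModel I k) I (proj I N k) (lieD I w b) := by
  refine DForm.ext_chartForm fun p => ?_
  have hp := mem_extChartAt_target (I := formModel I k) p
  have hW := hw.contDiffAt_chartField (mem_formBundle_chart_target.1 hp)
  have hb' := hb.contDiffAt_chartForm (mem_formBundle_chart_target.1 hp)
  have hp1 : (extChartAt (formModel I k) p p).1 = extChartAt I p.proj p.proj :=
    formBundle_chart_fst (mem_extChartAt_source p.proj)
  have h1 : chartForm (formModel I k) p (pullback (formModel I k) I (proj I N k) b) =ᶠ[
      𝓝 (extChartAt (formModel I k) p p)]
      fun z => (chartForm I p.proj b z.1).compContinuousLinearMap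
        (ContinuousLinearMap.fst ℝ E (E [⋀^Fin k]→L[ℝ] ℝ)) := by
    filter_upwards [(isOpen_extChartAt_target p).mem_nhds hp] with u hu
      using chartForm_pullback_proj hu b
  have h2 := lie_flatLift_comp_fst hW (hb'.differentiableAt (by simp))
  rw [chartForm_lieD_self, h1.fderiv_eq, chartForm_pullback_proj hp,
    (chartField_canonicalLift_eventuallyEq hw hp).fderiv_eq, chartField_canonicalLift hw hp,
    chartForm_pullback_proj hp, h2, hp1, chartForm_lieD_self]

/-- The global primitive reduces closedness to `d² = 0` and lets Cartan's formula be applied to a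
single form. -/
theorem magneticForm_eq_extD {b : DForm I N k} (hb : IsSmoothForm I b) :
    magneticForm b = extD (formModel I k)
      (theta I N k + pullback (formModel I k) I (proj I N k) b) := by
  rw [extD_add isSmoothForm_theta (hb.pullback contMDiff_formBundle_proj),
    extD_pullback contMDiff_formBundle_proj hb, magneticForm]

theorem extD_neg (α : DForm I N k) : extD I (-α) = -extD I α := by
  refine funext fun x => ?_
  simp only [extD, I.range_eq_univ, extDerivWithin_univ]
  exact (congrArg (ofChart I x) (extDeriv_neg (chartForm I x α) (extChartAt I x x))).trans
    (by simp only [Pi.neg_apply, extD, I.range_eq_univ, extDerivWithin_univ]; rfl)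

theorem chartForm_magneticForm {b : DForm I N k} (hb : IsSmoothForm I b)
    {p : FormBundle I N k} {z : E × (E [⋀^Fin k]→L[ℝ] ℝ)}
    (hz : z ∈ (extChartAt (formModel I k) p).target) :
    chartForm (formModel I k) p (magneticForm b) z = -extDeriv (flatTautological E k) z +
      (extDeriv (chartForm I p.proj b) z.1).compContinuousLinearMap
        (ContinuousLinearMap.fst ℝ E (E [⋀^Fin k]→L[ℝ] ℝ)) := by
  rw [magneticForm, chartForm_add, Pi.add_apply, chartForm_extD isSmoothForm_theta hz,
    (chartForm_theta_eventuallyEq hz).extDeriv_eq, extDeriv_neg, chartForm_pullback_proj hz,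
    chartForm_extD hb (mem_formBundle_chart_target.1 hz)]

theorem isPrePlectic_magneticForm {b : DForm I N k} (hb : IsSmoothForm I b) :
    IsPrePlectic (formModel I k) (magneticForm b) := by
  have h := isSmoothForm_theta.add (hb.pullback (contMDiff_formBundle_proj (k := k)))
  rw [magneticForm_eq_extD hb]
  exact ⟨h.extD, extD_extD h⟩

theorem isPlectic_magneticForm [FiniteDimensional ℝ E] {b : DForm I N (k + 1)}
    (hb : IsSmoothForm I b) (hk : k + 1 ≤ Module.finrank ℝ E) :
    IsPlectic (formModel I (k + 1)) (magneticForm b) := by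
  refine ⟨isPrePlectic_magneticForm hb, fun p u v huv => ?_⟩
  have hp := mem_extChartAt_target (I := formModel I (k + 1)) p
  classical
  -- Tangent vectors at `p` are extended by zero to possibly discontinuous fields, which is enough
  -- because the chart formula for interior products is pointwise.
  let U : VField (formModel I (k + 1)) (FormBundle I N (k + 1)) := Function.update (fun _ => 0) p u
  let V : VField (formModel I (k + 1)) (FormBundle I N (k + 1)) := Function.update (fun _ => 0) p v
  have hU : U p = u := Function.update_self ..
  have hV : V p = v := Function.update_self ..
  have h1 : chartForm _ p (interior _ U (magneticForm b)) (extChartAt (formModel I (k + 1)) p p) =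
      chartForm _ p (interior _ V (magneticForm b)) (extChartAt (formModel I (k + 1)) p p) := by
    refine chartForm_congr ?_
    rw [extChartAt_to_inv, interior, interior, hU, hV]
    exact huv
  rw [chartForm_interior hp, chartForm_interior hp, chartForm_magneticForm hb hp] at h1
  have h2 := injective_curryLeft_flat hk _ _ h1
  have h3 := mfderiv_chart_symm_chartField hp U
  have h4 := mfderiv_chart_symm_chartField hp V
  rw [h2, h4, extChartAt_to_inv, hU, hV] at h3
  exact h3.symm

theorem isHamiltonianField_canonicalLift {b : DForm I N (k + 1)} (hb : IsSmoothForm I b)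
    {w : VField I N} (hw : IsSmoothField I w) {a : DForm I N k} (ha : IsSmoothForm I a)
    (hab : lieD I w b = extD I a) :
    IsHamiltonianField (formModel I (k + 1)) (magneticForm b)
      (magneticHamiltonian w b a) (canonicalLift I (k + 1) w) := by
  have hπ := contMDiff_formBundle_proj (I := I) (N := N) (k := k + 1)
  have hX := isSmoothField_canonicalLift (k := k + 1) hw
  have hΘ := isSmoothForm_theta.add (hb.pullback hπ)
  have ha' := ha.pullback hπ
  refine ⟨ha'.neg.add (hΘ.interior hX), hX, ?_⟩
  have hC := extD_interior_add_interior_extD hX hΘ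
  -- The right side of Cartan's formula becomes `0 + π^*L_w b = π^*da`.
  rw [lieD_add isSmoothForm_theta (hb.pullback hπ), lieD_canonicalLift_theta hw, zero_add,
    lieD_canonicalLift_pullback hw hb, hab, ← magneticForm_eq_extD hb] at hC
  rw [magneticHamiltonian, extD_add ha'.neg (hΘ.interior hX), extD_neg, extD_pullback hπ ha, ← hC]
  abel

end BundleCharts

end Multisymplectic

/-- The degree of `b` is written `k + 1`, which encodes that it is at least `1`, and `Module.finrank
ℝ E` is the dimension of `N`. -/
theorem mainTheorem12 {E : Type*} [NormedAddCommGroup E] [NormedSpace ℝ E]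
    [FiniteDimensional ℝ E] {N : Type*} [TopologicalSpace N] [ChartedSpace E N]
    [IsManifold 𝓘(ℝ, E) ∞ N] (k : ℕ)
    (b : DForm 𝓘(ℝ, E) N (k + 1)) (hb : IsSmoothForm 𝓘(ℝ, E) b)
    (w : VField 𝓘(ℝ, E) N) (hw : IsSmoothField 𝓘(ℝ, E) w)
    (a : DForm 𝓘(ℝ, E) N k) (ha : IsSmoothForm 𝓘(ℝ, E) a)
    (hab : lieD 𝓘(ℝ, E) w b = extD 𝓘(ℝ, E) a) :
    IsPrePlectic (formModel 𝓘(ℝ, E) (k + 1)) (magneticForm b) ∧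
      (k + 1 ≤ Module.finrank ℝ E →
        IsPlectic (formModel 𝓘(ℝ, E) (k + 1)) (magneticForm b)) ∧
      IsHamiltonianField (formModel 𝓘(ℝ, E) (k + 1)) (magneticForm b)
        (magneticHamiltonian w b a) (canonicalLift 𝓘(ℝ, E) (k + 1) w) :=
  ⟨isPrePlectic_magneticForm hb, isPlectic_magneticForm hb,
    isHamiltonianField_canonicalLift hb hw ha hab⟩
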